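/- Let $\mathcal{H}_a$ and $\mathcal{H}_b$ be complex Hilbert spaces, with $\mathcal{H}_a$ of finite dimension $d_a$ and $\mathcal{H}_b$ separable, and let $\mathcal{H}=\mathcal{H}_a\otimes\mathcal{H}_b$ with unit sphere $\mathbb{S}(\mathcal{H})$. Let $\rho$ be a density matrix on $\mathcal{H}$, i.e. a positive trace-class operator with $\operatorname{tr}\rho=1$. The probability measure $\mathrm{GAP}(\rho)$ on $\mathbb{S}(\mathcal{H})$ is defined as follows: write $\rho=\sum_n p_n|n\rangle\langle n|$ with an orthonormal eigenbasis $(|n\rangle)_n$, let $Z_n$ be independent complex Gaussian random variables with mean $0$ and $\mathbb{E}|Z_n|^2=p_n$ (real and imaginary parts independent, each of mean $0$ and variance $p_n/2$), let $\mathrm{G}(\rho)$ be the distribution of $\sum_n Z_n|n\rangle$, let $\mathrm{GA}(\rho)(d\psi)=\|\psi\|^2\,\mathrm{G}(\rho)(d\psi)$, and let $\mathrm{GAP}(\rho)$ be the distribution of $\Psi/\|\Psi\|$ when $\Psi$ has distribution $\mathrm{GA}(\rho)$. Let $t\mapsto U_t$ be a measurable family of unitary operators on $\mathcal{H}$ (i.e.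 $t\mapsto U_t\phi$ is measurable for every $\phi\in\mathcal{H}$), and put $\psi_t=U_t\psi$, $\rho_t=U_t\,\rho\,U_t^*$ and $\rho_a^{\phi}=\operatorname{tr}_b|\phi\rangle\langle\phi|$, where $\operatorname{tr}_b$ denotes the partial trace over $\mathcal{H}_b$. Let $\|M\|_{\mathrm{tr}}=\operatorname{tr}\sqrt{M^*M}$ be the trace norm and $\|\rho\|$ the operator norm. Then for every $\varepsilon>0$ and $T>0$, the function $t\mapsto\|\rho_a^{\psi_t}-\operatorname{tr}_b\rho_t\|_{\mathrm{tr}}$ is integrable on $[0,T]$ for every $\psi\in\mathbb{S}(\mathcal{H})$, the event below is measurable, and $$\mathrm{GAP}(\rho)\left\{\psi\in\mathbb{S}(\mathcal{H}):\ \frac1T\int_0^T\bigl\|\rho_a^{\psi_t}-\operatorname{tr}_b\rho_t\bigr\|_{\mathrm{tr}}\,dt>\varepsilon\right\}\ \le\ 9\,d_a^2\exp\left(-\frac{\tilde C\varepsilon^2}{36\,d_a^2\,\|\rho\|}\right),\qquad \tilde C=\frac{1}{2304\pi^2}.$$ -/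

import Mathlib

open scoped TensorProduct InnerProductSpace ENNReal NNReal
open MeasureTheory ProbabilityTheory

/-- The tensor product of a finite-dimensional inner product space with a Hilbert space is
complete, so Mathlib's algebraic tensor product with its inner product
`⟪a ⊗ b, c ⊗ d⟫ = ⟪a, c⟫ ⟪b, d⟫` is already the Hilbert space tensor product. -/
instance TensorProduct.completeSpace_of_finiteDimensional {Ha Hb : Type*}
    [NormedAddCommGroup Ha] [InnerProductSpace ℂ Ha] [FiniteDimensional ℂ Ha]
    [NormedAddCommGroup Hb] [InnerProductSpace ℂ Hb] [CompleteSpace Hb] :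
    CompleteSpace (Ha ⊗[ℂ] Hb) := by
  classical
  let e := stdOrthonormalBasis ℂ Ha
  let n := Module.finrank ℂ Ha
  let Φ : PiLp 2 (fun _ : Fin n => Hb) →ₗ[ℂ] Ha ⊗[ℂ] Hb :=
    { toFun := fun v => ∑ i, e i ⊗ₜ[ℂ] v i
      map_add' := fun v w => by simp [TensorProduct.tmul_add, Finset.sum_add_distrib]
      map_smul' := fun c v => by simp [TensorProduct.tmul_smul, Finset.smul_sum] }
  let Ψ : PiLp 2 (fun _ : Fin n => Hb) →ₗᵢ[ℂ] Ha ⊗[ℂ] Hb := Φ.isometryOfInner (by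
    intro v w
    simp only [Φ, LinearMap.coe_mk, AddHom.coe_mk, sum_inner, inner_sum,
      TensorProduct.inner_tmul, PiLp.inner_apply]
    refine Finset.sum_congr rfl fun i _ => ?_
    rw [Finset.sum_eq_single i]
    · simp
    · intro j _ hj
      simp [e.inner_eq_ite, hj]
    · simp)
  have hsurj : Function.Surjective Ψ := by
    rw [← LinearIsometry.coe_toLinearMap, ← LinearMap.range_eq_top, eq_top_iff,
      ← TensorProduct.span_tmul_eq_top, Submodule.span_le]
    rintro _ ⟨a, y, rfl⟩
    refine ⟨WithLp.toLp 2 fun i => (⟪e i, a⟫_ℂ) • y, ?_⟩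
    change ∑ i, e i ⊗ₜ[ℂ] ((⟪e i, a⟫_ℂ) • y) = a ⊗ₜ[ℂ] y
    simp only [← TensorProduct.smul_tmul, ← TensorProduct.sum_tmul]
    rw [e.sum_repr' a]
  exact (completeSpace_congr (e := (LinearIsometryEquiv.ofSurjective Ψ hsurj).toEquiv)
    (LinearIsometryEquiv.ofSurjective Ψ hsurj).isometry.isUniformEmbedding).1 inferInstance

section GAPMeasures

variable {H : Type*} [NormedAddCommGroup H] [InnerProductSpace ℂ H]

/-- A density matrix: a positive (bounded, self-adjoint) operator with trace one. For a positive
operator the trace `∑ ⟪e i, ρ (e i)⟫` has the same value in `[0, ∞]` for every orthonormal basis,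
so it may be computed in any one of them. -/
structure DensityOperator (H : Type*) [NormedAddCommGroup H] [InnerProductSpace ℂ H] where
  op : H →L[ℂ] H
  isPositive : op.IsPositive
  trace_eq_one : ∃ (w : Set H) (e : HilbertBasis w ℂ H), HasSum (fun i => ⟪e i, op (e i)⟫_ℂ) 1

theorem DensityOperator.isCompactOperator [CompleteSpace H] (ρ : DensityOperator H) :
    IsCompactOperator ρ.op := by
  obtain ⟨w, e, he⟩ := ρ.trace_eq_one
  set S : H →L[ℂ] H := CFC.sqrt ρ.op with hS
  have hpos : 0 ≤ ρ.op := (ContinuousLinearMap.nonneg_iff_isPositive _).2 ρ.isPositive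
  have hSS : S * S = ρ.op := CFC.sqrt_mul_sqrt_self ρ.op hpos
  have hSp : S.IsPositive :=
    (ContinuousLinearMap.nonneg_iff_isPositive _).1 (CFC.sqrt_nonneg ρ.op)
  have hnorm : ∀ y, ‖S y‖ ^ 2 = (⟪y, ρ.op y⟫_ℂ).re := by
    intro y
    rw [← hSS, mul_apply_eq_comp, ← hSp.inner_left_eq_inner_right,
      inner_self_eq_norm_sq_to_K]
    norm_cast
  have hsum : Summable fun i => ‖ρ.op (e i)‖ ^ 2 := by
    have h1 : Summable fun i => ‖S‖ ^ 2 * ‖S (e i)‖ ^ 2 := by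
      refine Summable.mul_left _ ?_
      simp only [hnorm]
      exact (Complex.hasSum_re he).summable
    refine Summable.of_nonneg_of_le (fun _ => by positivity) (fun i => ?_) h1
    rw [← mul_pow, ← hSS, mul_apply_eq_comp]
    gcongr
    exact S.le_opNorm _
  let R : w → (H →L[ℂ] H) := fun i => InnerProductSpace.rankOne ℂ (ρ.op (e i)) (e i)
  have hR : ∀ t : Finset w, ‖∑ i ∈ t, R i‖ ≤ √(∑ i ∈ t, ‖ρ.op (e i)‖ ^ 2) := by
    intro t
    refine ContinuousLinearMap.opNorm_le_bound _ (Real.sqrt_nonneg _) fun x => ?_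
    calc ‖(∑ i ∈ t, R i) x‖ ≤ ∑ i ∈ t, ‖ρ.op (e i)‖ * ‖⟪e i, x⟫_ℂ‖ := by
          rw [sum_apply]
          refine norm_sum_le_of_le _ fun i _ => ?_
          simp [R, norm_smul, mul_comm]
      _ ≤ √(∑ i ∈ t, ‖ρ.op (e i)‖ ^ 2) * √(∑ i ∈ t, ‖⟪e i, x⟫_ℂ‖ ^ 2) :=
          Real.sum_mul_le_sqrt_mul_sqrt _ _ _
      _ ≤ √(∑ i ∈ t, ‖ρ.op (e i)‖ ^ 2) * ‖x‖ := by
          gcongr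
          exact Real.sqrt_le_iff.2 ⟨norm_nonneg _, e.orthonormal.sum_inner_products_le x⟩
  have hRs : Summable R := by
    rw [summable_iff_vanishing_norm]
    intro ε hε
    obtain ⟨s, hs⟩ := summable_iff_vanishing_norm.1 hsum (ε ^ 2) (by positivity)
    refine ⟨s, fun t ht => (hR t).trans_lt ?_⟩
    rw [Real.sqrt_lt' hε]
    exact (le_abs_self _).trans_lt (hs t ht)
  have hlim : ρ.op = ∑' i, R i := by
    ext x
    have h1 := (e.hasSum_repr x).mapL ρ.op
    have h2 := hRs.hasSum.mapL (ContinuousLinearMap.apply ℂ H x)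
    refine h1.unique ?_
    simpa [R, e.repr_apply_apply] using h2
  have ht : Filter.Tendsto (fun t : Finset w => ∑ i ∈ t, R i) Filter.atTop (nhds ρ.op) := by
    rw [hlim]; exact hRs.hasSum
  refine isCompactOperator_of_tendsto ht (Filter.Eventually.of_forall fun t => ?_)
  have : (∑ i ∈ t, R i) ∈ compactOperator (RingHom.id ℂ) H H := by
    refine Submodule.sum_mem _ fun i _ => ?_
    change IsCompactOperator (R i)
    have h : IsCompactOperator (ContinuousLinearMap.toSpanSingleton ℂ (ρ.op (e i))) :=
      isCompactOperator_of_locallyCompactSpace_rng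
        (ContinuousLinearMap.toSpanSingleton ℂ (ρ.op (e i)))
    exact h.comp_clm (innerSL ℂ (e i))
  exact this


theorem DensityOperator.exists_eigenbasis [CompleteSpace H] (ρ : DensityOperator H) :
    ∃ (w : Set H) (e : HilbertBasis w ℂ H) (p : w → ℝ≥0), ∀ i, ρ.op (e i) = (p i : ℂ) • e i := by
  have hsym : (ρ.op : H →ₗ[ℂ] H).IsSymmetric := ρ.isPositive.isSymmetric
  have hbot := ContinuousLinearMap.orthogonalComplement_iSup_eigenspaces_eq_bot
    ρ.isCompactOperator hsym
  let K : ℂ → Submodule ℂ H := fun μ => Module.End.eigenspace (ρ.op : H →ₗ[ℂ] H) μ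
  have hK : ∀ μ, CompleteSpace (K μ) := by
    intro μ
    have : IsClosed (K μ : Set H) := by
      have : (K μ : Set H) = {x | ρ.op x = μ • x} := by
        ext x; simp [K]
      rw [this]
      exact isClosed_eq ρ.op.continuous (continuous_const_smul μ)
    exact this.completeSpace_coe
  choose w b hb using fun μ => exists_hilbertBasis ℂ (K μ)
  have horth : Orthonormal ℂ (fun a : Σ μ, w μ => ((b a.1 a.2 : K a.1) : H)) :=
    hsym.orthogonalFamily_eigenspaces.orthonormal_sigma_orthonormal
      (v_family := fun μ => b μ) (fun μ => (b μ).orthonormal)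
  let v : Set H := Set.range (fun a : Σ μ, w μ => ((b a.1 a.2 : K a.1) : H))
  have hv : Orthonormal ℂ ((↑) : v → H) := horth.toSubtypeRange
  have hsp : (Submodule.span ℂ (Set.range ((↑) : v → H)))ᗮ = ⊥ := by
    rw [eq_bot_iff, ← hbot, Subtype.range_coe]
    intro x hx
    rw [← Submodule.iInf_orthogonal, Submodule.mem_iInf]
    intro μ
    rw [Submodule.mem_orthogonal']
    intro y hy
    have h1 := ((b μ).hasSum_repr ⟨y, hy⟩).mapL ((innerSL ℂ x) ∘L (K μ).subtypeL)
    have h2 : ∀ i, ((innerSL ℂ x) ∘L (K μ).subtypeL) ((b μ).repr ⟨y, hy⟩ i • b μ i) = 0 := by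
      intro i
      have : ⟪x, ((b μ i : K μ) : H)⟫_ℂ = 0 :=
        (Submodule.mem_orthogonal' _ _).1 hx _ (Submodule.subset_span ⟨⟨μ, i⟩, rfl⟩)
      simp [this]
    simp only [h2] at h1
    exact h1.unique hasSum_zero
  refine ⟨v, HilbertBasis.mkOfOrthogonalEqBot hv hsp,
    fun i => Real.toNNReal (⟪(i : H), ρ.op i⟫_ℂ).re, ?_⟩
  rintro ⟨_, ⟨⟨μ, i⟩, rfl⟩⟩
  rw [HilbertBasis.coe_mkOfOrthogonalEqBot]
  set x : H := ((b μ i : K μ) : H)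
  have hx1 : ‖x‖ = 1 := (b μ).orthonormal.1 i
  have hx : ρ.op x = μ • x := Module.End.mem_eigenspace_iff.1 (b μ i).2
  have hμ : ⟪x, ρ.op x⟫_ℂ = μ := by
    rw [hx, inner_smul_right, inner_self_eq_norm_sq_to_K, hx1]; simp
  have hpos := ρ.isPositive.inner_nonneg_right x
  rw [hμ] at hpos
  obtain ⟨h1, h2⟩ := Complex.nonneg_iff.1 hpos
  change ρ.op x = (((⟪x, ρ.op x⟫_ℂ).re.toNNReal : ℝ) : ℂ) • x
  rw [hμ, Real.coe_toNNReal _ h1, hx]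
  congr 1
  exact Complex.ext (by simp) (by simp [← h2])


theorem HilbertBasis.ofReal_norm_sq_eq_tsum {ι : Type*} (g : HilbertBasis ι ℂ H) (y : H) :
    ENNReal.ofReal (‖y‖ ^ 2) = ∑' k, ENNReal.ofReal (‖⟪g k, y⟫_ℂ‖ ^ 2) := by
  have h := Complex.hasSum_re (g.hasSum_inner_mul_inner y y)
  have h1 : ∀ k, (⟪y, g k⟫_ℂ * ⟪g k, y⟫_ℂ).re = ‖⟪g k, y⟫_ℂ‖ ^ 2 := by
    intro k
    rw [← inner_conj_symm, Complex.conj_mul', ← Complex.ofReal_pow, Complex.ofReal_re]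
  simp only [h1] at h
  have h2 : (⟪y, y⟫_ℂ).re = ‖y‖ ^ 2 := by
    rw [inner_self_eq_norm_sq_to_K]; norm_cast
  rw [h2] at h
  rw [← h.tsum_eq, ENNReal.ofReal_tsum_of_nonneg (fun _ => by positivity) h.summable]

theorem DensityOperator.tsum_ofReal_inner_eq_one [CompleteSpace H] (ρ : DensityOperator H)
    {ι : Type*} (f : HilbertBasis ι ℂ H) :
    ∑' i, ENNReal.ofReal (⟪f i, ρ.op (f i)⟫_ℂ).re = 1 := by
  obtain ⟨w, e, he⟩ := ρ.trace_eq_one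
  set S : H →L[ℂ] H := CFC.sqrt ρ.op with hS
  have hpos : 0 ≤ ρ.op := (ContinuousLinearMap.nonneg_iff_isPositive _).2 ρ.isPositive
  have hSS : S * S = ρ.op := CFC.sqrt_mul_sqrt_self ρ.op hpos
  have hSp : S.IsPositive :=
    (ContinuousLinearMap.nonneg_iff_isPositive _).1 (CFC.sqrt_nonneg ρ.op)
  have hnorm : ∀ y, (⟪y, ρ.op y⟫_ℂ).re = ‖S y‖ ^ 2 := by
    intro y
    rw [← hSS, mul_apply_eq_comp, ← hSp.inner_left_eq_inner_right,
      inner_self_eq_norm_sq_to_K]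
    norm_cast
  have h1 : ∑' i, ENNReal.ofReal (⟪e i, ρ.op (e i)⟫_ℂ).re = 1 := by
    have h := Complex.hasSum_re he
    rw [← ENNReal.ofReal_tsum_of_nonneg (fun i => by rw [hnorm]; positivity) h.summable,
      h.tsum_eq]
    simp
  rw [← h1]
  simp only [hnorm]
  calc ∑' i, ENNReal.ofReal (‖S (f i)‖ ^ 2)
      = ∑' i, ∑' k, ENNReal.ofReal (‖⟪e k, S (f i)⟫_ℂ‖ ^ 2) := by
        simp only [e.ofReal_norm_sq_eq_tsum]
    _ = ∑' k, ∑' i, ENNReal.ofReal (‖⟪e k, S (f i)⟫_ℂ‖ ^ 2) := ENNReal.tsum_comm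
    _ = ∑' k, ∑' i, ENNReal.ofReal (‖⟪f i, S (e k)⟫_ℂ‖ ^ 2) := by
        refine tsum_congr fun k => tsum_congr fun i => ?_
        rw [← hSp.inner_left_eq_inner_right, ← inner_conj_symm, RCLike.norm_conj]
    _ = ∑' k, ENNReal.ofReal (‖S (e k)‖ ^ 2) := by
        simp only [f.ofReal_norm_sq_eq_tsum]

theorem HilbertBasis.countable [TopologicalSpace.SeparableSpace H] {ι : Type*}
    (e : HilbertBasis ι ℂ H) : Countable ι := by
  refine Pairwise.countable_of_isOpen_disjoint (s := fun i => Metric.ball (e i) (1 / 2)) ?_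
    (fun i => Metric.isOpen_ball) (fun i => ⟨e i, Metric.mem_ball_self (by norm_num)⟩)
  intro i j hij
  refine Metric.ball_disjoint_ball ?_
  have h : ‖e i - e j‖ ^ 2 = 2 := by
    rw [@norm_sub_sq ℂ, e.orthonormal.1, e.orthonormal.1, e.orthonormal.2 hij]; norm_num
  rw [dist_eq_norm]
  nlinarith [norm_nonneg (e i - e j)]

/-- The centred complex Gaussian distribution with variance `E|Z|² = v`: real and imaginary part
are independent, real Gaussian, each with mean `0` and variance `v / 2`. -/
noncomputable def complexGaussian (v : ℝ≥0) : Measure ℂ :=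
  ((gaussianReal 0 (v / 2)).prod (gaussianReal 0 (v / 2))).map
    Complex.measurableEquivRealProd.symm

instance (v : ℝ≥0) : IsProbabilityMeasure (complexGaussian v) :=
  Measure.isProbabilityMeasure_map Complex.measurableEquivRealProd.symm.measurable.aemeasurable

theorem lintegral_sq_gaussianReal (v : ℝ≥0) :
    ∫⁻ x, ENNReal.ofReal (x ^ 2) ∂gaussianReal 0 v = v := by
  have h := evariance_eq_lintegral_ofReal (fun x : ℝ => x) (gaussianReal 0 v)
  simp only [integral_id_gaussianReal, sub_zero] at h
  have hm : MemLp (fun x : ℝ => x) 2 (gaussianReal 0 v) := memLp_id_gaussianReal 2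
  rw [← h, ← hm.ofReal_variance_eq, variance_fun_id_gaussianReal]
  simp

theorem lintegral_norm_sq_complexGaussian (v : ℝ≥0) :
    ∫⁻ z, ENNReal.ofReal (‖z‖ ^ 2) ∂complexGaussian v = v := by
  rw [complexGaussian, lintegral_map (by fun_prop) (MeasurableEquiv.measurable _)]
  have h : ∀ x : ℝ × ℝ, ENNReal.ofReal (‖Complex.measurableEquivRealProd.symm x‖ ^ 2)
      = ENNReal.ofReal (x.1 ^ 2) + ENNReal.ofReal (x.2 ^ 2) := by
    intro x
    rw [← ENNReal.ofReal_add (by positivity) (by positivity), Complex.sq_norm,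
      Complex.normSq_apply]
    simp [Complex.measurableEquivRealProd_symm_apply, sq]
  simp only [h]
  rw [lintegral_add_left (by fun_prop)]
  have h1 := (measurePreserving_fst (μ := gaussianReal 0 (v / 2))
    (ν := gaussianReal 0 (v / 2))).lintegral_comp
    (f := fun x : ℝ => ENNReal.ofReal (x ^ 2)) (by fun_prop)
  have h2 := (measurePreserving_snd (μ := gaussianReal 0 (v / 2))
    (ν := gaussianReal 0 (v / 2))).lintegral_comp
    (f := fun x : ℝ => ENNReal.ofReal (x ^ 2)) (by fun_prop)
  rw [h1, h2, lintegral_sq_gaussianReal, ← ENNReal.coe_add, add_halves]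

/-- The vector `∑ z i • e i` with coordinates `z`. -/
noncomputable def gaussianVector {ι : Type*} (e : HilbertBasis ι ℂ H) (z : ι → ℂ) : H :=
  ∑' i, z i • e i

/-- The joint law of independent centred complex Gaussians `Z i` with variances `p i`. -/
noncomputable def coordLaw {ι : Type*} (p : ι → ℝ≥0) : Measure (ι → ℂ) :=
  Measure.infinitePi fun i => complexGaussian (p i)

instance {ι : Type*} (p : ι → ℝ≥0) : IsProbabilityMeasure (coordLaw p) := by
  unfold coordLaw; infer_instance

theorem lintegral_coordLaw {ι : Type*} [Countable ι] (p : ι → ℝ≥0) :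
    ∫⁻ z, ∑' i, ENNReal.ofReal (‖z i‖ ^ 2) ∂coordLaw p = ∑' i, (p i : ℝ≥0∞) := by
  rw [lintegral_tsum (fun i => Measurable.aemeasurable (by fun_prop))]
  refine tsum_congr fun i => ?_
  rw [← lintegral_norm_sq_complexGaussian (p i),
    ← Measure.infinitePi_map_eval (fun i => complexGaussian (p i)) i,
    lintegral_map (by fun_prop) (by fun_prop)]
  rfl

theorem ae_hasSum_gaussianVector [CompleteSpace H] {ι : Type*} [Countable ι]
    (e : HilbertBasis ι ℂ H) {p : ι → ℝ≥0} (hp : ∑' i, (p i : ℝ≥0∞) ≠ ∞) :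
    ∀ᵐ z ∂coordLaw p, HasSum (fun i => z i • e i) (gaussianVector e z) := by
  have h : ∀ᵐ z ∂coordLaw p, ∑' i, ENNReal.ofReal (‖z i‖ ^ 2) < ∞ := by
    refine ae_lt_top (by fun_prop) ?_
    rwa [lintegral_coordLaw]
  filter_upwards [h] with z hz
  have hs : Summable fun i => ‖z i‖ ^ 2 := by
    have := ENNReal.summable_toReal hz.ne
    simpa [ENNReal.toReal_ofReal] using this
  have hmem : Memℓp z 2 := memℓp_gen (by simpa using hs)
  have := e.hasSum_repr_symm ⟨z, hmem⟩
  exact this.summable.hasSum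

theorem aemeasurable_gaussianVector [CompleteSpace H] [TopologicalSpace.SeparableSpace H]
    [MeasurableSpace H] [BorelSpace H] {ι : Type*} [Countable ι]
    (e : HilbertBasis ι ℂ H) {p : ι → ℝ≥0} (hp : ∑' i, (p i : ℝ≥0∞) ≠ ∞) :
    AEMeasurable (gaussianVector e) (coordLaw p) := by
  have := UniformSpace.secondCountable_of_separable H
  refine aemeasurable_of_tendsto_metrizable_ae (Filter.atTop : Filter (Finset ι))
    (f := fun s z => ∑ i ∈ s, z i • e i) (fun s => ?_) ?_
  · exact Measurable.aemeasurable (by fun_prop)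
  · exact ae_hasSum_gaussianVector e hp

/-- The Gaussian measure `G`: the law of `∑ Z i • e i` with `Z i` independent centred complex
Gaussians of variance `p i`. -/
noncomputable def gaussianMeasure [MeasurableSpace H] {ι : Type*} (e : HilbertBasis ι ℂ H)
    (p : ι → ℝ≥0) : Measure H :=
  (coordLaw p).map (gaussianVector e)

/-- The adjusted Gaussian measure `GA`: it has density `‖ψ‖²` relative to `G`. -/
noncomputable def adjustedGaussianMeasure [MeasurableSpace H] {ι : Type*}
    (e : HilbertBasis ι ℂ H) (p : ι → ℝ≥0) : Measure H :=
  (gaussianMeasure e p).withDensity fun ψ => ENNReal.ofReal (‖ψ‖ ^ 2)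

theorem isProbabilityMeasure_adjustedGaussianMeasure [CompleteSpace H]
    [TopologicalSpace.SeparableSpace H] [MeasurableSpace H] [BorelSpace H] {ι : Type*}
    (e : HilbertBasis ι ℂ H) {p : ι → ℝ≥0} (hp : ∑' i, (p i : ℝ≥0∞) = 1) :
    IsProbabilityMeasure (adjustedGaussianMeasure e p) := by
  have := e.countable
  have hp' : ∑' i, (p i : ℝ≥0∞) ≠ ∞ := by simp [hp]
  constructor
  rw [adjustedGaussianMeasure, withDensity_apply _ MeasurableSet.univ, Measure.restrict_univ,
    gaussianMeasure, lintegral_map' (by fun_prop) (aemeasurable_gaussianVector e hp'), ← hp,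
    ← lintegral_coordLaw]
  refine lintegral_congr_ae ?_
  filter_upwards [ae_hasSum_gaussianVector e hp'] with z hz
  rw [e.ofReal_norm_sq_eq_tsum]
  refine tsum_congr fun k => ?_
  have h1 : ⟪e k, gaussianVector e z⟫_ℂ = z k := by
    have h2 := hz.mapL (innerSL ℂ (e k))
    classical
    have h3 := hasSum_single (f := fun i => innerSL ℂ (e k) (z i • e i)) k (by
      intro j hj
      simp [e.orthonormal.2 hj.symm])
    have h4 := h2.unique h3
    simpa [e.orthonormal.1] using h4
  rw [h1]

/-- The law of `Ψ / ‖Ψ‖` on the unit sphere, where `Ψ` is `GA`-distributed (`Ψ ≠ 0` almost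
surely). -/
noncomputable def scroogeMeasure [MeasurableSpace H] {ι : Type*} (e : HilbertBasis ι ℂ H)
    (p : ι → ℝ≥0) : Measure (Metric.sphere (0 : H) 1) :=
  ((adjustedGaussianMeasure e p).map fun ψ => (‖ψ‖ : ℂ)⁻¹ • ψ).comap Subtype.val

theorem isProbabilityMeasure_scroogeMeasure [CompleteSpace H]
    [TopologicalSpace.SeparableSpace H] [MeasurableSpace H] [BorelSpace H] {ι : Type*}
    (e : HilbertBasis ι ℂ H) {p : ι → ℝ≥0} (hp : ∑' i, (p i : ℝ≥0∞) = 1) :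
    IsProbabilityMeasure (scroogeMeasure e p) := by
  have := UniformSpace.secondCountable_of_separable H
  have h := isProbabilityMeasure_adjustedGaussianMeasure e hp
  have hS : MeasurableSet (Metric.sphere (0 : H) 1) := Metric.isClosed_sphere.measurableSet
  have hmeas : Measurable fun ψ : H => (‖ψ‖ : ℂ)⁻¹ • ψ := by fun_prop
  constructor
  rw [scroogeMeasure, (MeasurableEmbedding.subtype_coe hS).comap_apply, Set.image_univ,
    Subtype.range_coe, Measure.map_apply hmeas hS]
  have h0 : adjustedGaussianMeasure e p {(0 : H)} = 0 := by
    rw [adjustedGaussianMeasure, withDensity_apply _ (measurableSet_singleton _)]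
    rw [setLIntegral_congr_fun (g := fun _ => 0) (measurableSet_singleton _)
      (by intro x hx; rw [Set.mem_singleton_iff.1 hx]; simp)]
    simp
  have h1 : ((fun ψ : H => (‖ψ‖ : ℂ)⁻¹ • ψ) ⁻¹' Metric.sphere (0 : H) 1) = {(0 : H)}ᶜ := by
    ext ψ
    by_cases hψ : ψ = 0
    · simp [hψ]
    · simp [hψ, norm_smul]
  rw [h1, prob_compl_eq_one_iff (measurableSet_singleton _), h0]

/-- The measure `GAP(ρ)` on the unit sphere, built from an orthonormal eigenbasis of `ρ` and the
corresponding eigenvalues. The measure does not depend on which eigenbasis is taken. -/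
noncomputable def GAP [CompleteSpace H] [MeasurableSpace H] (ρ : DensityOperator H) :
    Measure (Metric.sphere (0 : H) 1) :=
  scroogeMeasure ρ.exists_eigenbasis.choose_spec.choose
    ρ.exists_eigenbasis.choose_spec.choose_spec.choose

instance [CompleteSpace H] [TopologicalSpace.SeparableSpace H] [MeasurableSpace H] [BorelSpace H]
    (ρ : DensityOperator H) : IsProbabilityMeasure (GAP ρ) := by
  refine isProbabilityMeasure_scroogeMeasure _ ?_
  have he := ρ.exists_eigenbasis.choose_spec.choose_spec.choose_spec
  rw [← ρ.tsum_ofReal_inner_eq_one ρ.exists_eigenbasis.choose_spec.choose]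
  refine tsum_congr fun i => ?_
  rw [he i, inner_smul_right, inner_self_eq_norm_sq_to_K,
    ρ.exists_eigenbasis.choose_spec.choose.orthonormal.1]
  simp

end GAPMeasures

section Bipartite

variable {Ha Hb : Type*} [NormedAddCommGroup Ha] [InnerProductSpace ℂ Ha]
  [NormedAddCommGroup Hb] [InnerProductSpace ℂ Hb]

/-- The partial inner product with `l` in the second factor: `a ⊗ b ↦ ⟪l, b⟫ • a`. -/
noncomputable def partialInner (l : Hb) : Ha ⊗[ℂ] Hb →ₗ[ℂ] Ha :=
  (TensorProduct.rid ℂ Ha).toLinearMap ∘ₗ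
    LinearMap.lTensor Ha (innerSL ℂ l : Hb →ₗ[ℂ] ℂ)

/-- The operator `a ↦ ⟨l| T |a ⊗ l⟩` on the first factor; its matrix elements are
`⟪a ⊗ l, T (c ⊗ l)⟫`. -/
noncomputable def partialDiag [FiniteDimensional ℂ Ha]
    (T : (Ha ⊗[ℂ] Hb) →L[ℂ] (Ha ⊗[ℂ] Hb)) (l : Hb) : Ha →L[ℂ] Ha :=
  LinearMap.toContinuousLinearMap
    (partialInner l ∘ₗ (T : Ha ⊗[ℂ] Hb →ₗ[ℂ] Ha ⊗[ℂ] Hb) ∘ₗ (TensorProduct.mk ℂ Ha Hb).flip l)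

/-- The partial trace over the second factor, `⟪a, (tr_b T) c⟫ = ∑ ⟪a ⊗ l, T (c ⊗ l)⟫`, the sum
running over an orthonormal basis of the second factor. For trace-class `T` the sum converges and
does not depend on the basis. -/
noncomputable def partialTrace [FiniteDimensional ℂ Ha] [CompleteSpace Hb]
    (T : (Ha ⊗[ℂ] Hb) →L[ℂ] (Ha ⊗[ℂ] Hb)) : Ha →L[ℂ] Ha :=
  ∑' i, partialDiag T ((exists_hilbertBasis ℂ Hb).choose_spec.choose i)

/-- The reduced density matrix `tr_b |ψ⟩⟨ψ|` of a vector `ψ`. -/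
noncomputable def reducedDensity [FiniteDimensional ℂ Ha] [CompleteSpace Hb] (ψ : Ha ⊗[ℂ] Hb) :
    Ha →L[ℂ] Ha :=
  partialTrace (InnerProductSpace.rankOne ℂ ψ ψ)

/-- The trace norm `tr |M| = tr √(M* M)` of an operator on a finite-dimensional space. -/
noncomputable def traceNorm [FiniteDimensional ℂ Ha] (M : Ha →L[ℂ] Ha) : ℝ :=
  haveI : CompleteSpace Ha := FiniteDimensional.complete ℂ Ha
  (LinearMap.trace ℂ Ha (CFC.sqrt (star M * M) : Ha →L[ℂ] Ha)).re

/-- The distance `‖ρ_a^{ψ_t} - tr_b ρ_t‖_tr` at time `t`, where `ψ_t = U_t ψ` and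
`ρ_t = U_t ρ U_t^*`. -/
noncomputable def reducedDeviation [FiniteDimensional ℂ Ha] [CompleteSpace Hb]
    (ρ : DensityOperator (Ha ⊗[ℂ] Hb))
    (U : ℝ → unitary ((Ha ⊗[ℂ] Hb) →L[ℂ] (Ha ⊗[ℂ] Hb))) (ψ : Ha ⊗[ℂ] Hb) (t : ℝ) : ℝ :=
  traceNorm (reducedDensity ((U t : (Ha ⊗[ℂ] Hb) →L[ℂ] (Ha ⊗[ℂ] Hb)) ψ) -
    partialTrace ((U t : (Ha ⊗[ℂ] Hb) →L[ℂ] (Ha ⊗[ℂ] Hb)) * ρ.op *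
      star (U t : (Ha ⊗[ℂ] Hb) →L[ℂ] (Ha ⊗[ℂ] Hb))))

end Bipartite

/-! The proof works with exponential moments throughout. A matrix element of ρ_a^{ψ_t} − tr_b ρ_t is
a deviation ⟨ψ, Cψ⟩ − tr(ρC) with C = U_t^* (|c⟩⟨a| ⊗ 1) U_t. Conjugation by U_t preserves operator
norms, so a moment bound that only uses ‖C‖ ≤ 1 and ‖ρ‖ holds at all times with the same constants.

Such a bound is Gaussian calculus. For Ψ distributed by G(ρ), ⟨Ψ, DΨ⟩ is a quadratic form in
independent Gaussians, and diagonalising it gives E exp Re⟨Ψ, DΨ⟩ ≤ exp(Re tr(ρD) + ‖ρ‖ ‖D‖²) when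
‖D‖ ‖ρ‖ ≤ 1/2 (`lintegral_exp_inner_gaussianVector_le`). Under GAP one integrates f(Ψ/‖Ψ‖) with the
weight ‖Ψ‖². The pointwise inequality `mul_exp_div_le` replaces the resulting quotient by three
exponentials of quadratic forms, one of which pays for the unlikely event ‖Ψ‖² < 1/2. This yields
`lintegral_exp_norm_scroogeMeasure_le`.

The trace norm is at most √d_a times the Hilbert–Schmidt norm. The latter is a mean square of
deviations of contractions, namely shifts of a basis of the first factor decorated with random signs
(`traceNorm_le_card_mul_sqrt_average`). The trace norm is thus at most d_a times a root mean square
of deviations; treating the entries one at a time would cost a further √d_a.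

Finally, a Bernoulli-type inequality (`one_add_mul_sub_one_le_average_exp`) bounds an affine
function of the trace norm by an average of exponentials of deviations. Affine functions commute
with the time average, so Fubini and Markov's inequality finish the argument without a union bound
(`scroogeMeasure_timeAverage_le`). With ε = d_a δ the exponent obtained is δ²/(512 ‖ρ‖), stronger
than required; in the parameter ranges left over the event is empty or the claimed bound exceeds 1.
-/

/-! ### Laplace transforms of real Gaussian quadratic forms -/

/-- This is −log(1 − y) ≤ y + y². For y ≤ 0 the linear bound on exp suffices, since (1 − y)(1 + y +
y²) = 1 − y³; for y ≥ 0 the quadratic term is needed. -/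
theorem one_le_one_sub_mul_exp {y : ℝ} (hy : |y| ≤ 1 / 2) :
    1 ≤ (1 - y) * Real.exp (y + y ^ 2) := by
  obtain ⟨h1, h2⟩ := abs_le.1 hy
  rcases le_total 0 y with h | h
  · have := Real.quadratic_le_exp_of_nonneg (x := y + y ^ 2) (by positivity)
    calc (1 : ℝ) ≤ (1 - y) * (1 + (y + y ^ 2) + (y + y ^ 2) ^ 2 / 2) := by
          -- The excess of the right-hand side over 1 is exactly the quantity in `h3` plus half of
          -- that in `h4`.
          have h3 : 0 ≤ y ^ 2 * (1 / 2 - y) * (1 + y) := by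
            have : 0 ≤ 1 / 2 - y := by linarith
            positivity
          have h4 : 0 ≤ y ^ 4 * (1 - y) := by
            have : 0 ≤ 1 - y := by linarith
            positivity
          nlinarith
      _ ≤ _ := by gcongr; linarith
  · have := Real.add_one_le_exp (y + y ^ 2)
    calc (1 : ℝ) ≤ (1 - y) * (y + y ^ 2 + 1) := by
          have : 0 ≤ y ^ 2 * (-y) := by
            have : 0 ≤ -y := by linarith
            positivity
          nlinarith
      _ ≤ _ := by gcongr; linarith

theorem integrable_exp_mul_sq_gaussianReal {m : ℝ} (hm : |m| ≤ 1 / 4) :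
    Integrable (fun x => Real.exp (m * x ^ 2)) (gaussianReal 0 1) := by
  obtain ⟨h1, h2⟩ := abs_le.1 hm
  rw [gaussianReal_of_var_ne_zero _ one_ne_zero]
  rw [integrable_withDensity_iff (by fun_prop) (by simp [gaussianPDF])]
  have := (integrable_exp_neg_mul_sq (b := 1 / 2 - m) (by linarith)).const_mul (√(2 * Real.pi))⁻¹
  refine this.congr (Filter.Eventually.of_forall fun x => ?_)
  simp only [gaussianPDF, gaussianPDFReal]
  rw [ENNReal.toReal_ofReal (by positivity), mul_left_comm, ← Real.exp_add]
  simp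
  left; ring

/-- The integral equals (1 − 2m)^(−1/2), and the square of the claim is the preceding inequality at
y = 2m. -/
theorem integral_exp_mul_sq_gaussianReal_le {m : ℝ} (hm : |m| ≤ 1 / 4) :
    ∫ x, Real.exp (m * x ^ 2) ∂gaussianReal 0 1 ≤ Real.exp (m + 2 * m ^ 2) := by
  obtain ⟨h1, h2⟩ := abs_le.1 hm
  rw [integral_gaussianReal_eq_integral_smul one_ne_zero]
  have h : ∀ x, gaussianPDFReal 0 1 x • Real.exp (m * x ^ 2)
      = (√(2 * Real.pi))⁻¹ * Real.exp (-(1 / 2 - m) * x ^ 2) := by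
    intro x
    simp only [gaussianPDFReal, smul_eq_mul]
    rw [mul_assoc, ← Real.exp_add]
    simp
    left; ring
  simp only [h]
  rw [integral_const_mul, integral_gaussian, ← Real.sqrt_inv, ← Real.sqrt_mul (by positivity)]
  refine Real.sqrt_le_iff.2 ⟨by positivity, ?_⟩
  rw [← Real.exp_nat_mul]
  have h3 := one_le_one_sub_mul_exp (y := 2 * m) (by rw [abs_mul, abs_two]; linarith)
  have h4 : (2 * Real.pi)⁻¹ * (Real.pi / (1 / 2 - m)) = 1 / (1 - 2 * m) := by
    have : 1 / 2 - m ≠ 0 := by linarith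
    have : 1 - 2 * m ≠ 0 := by linarith
    field_simp
  have h5 : ((2 : ℕ) : ℝ) * (m + 2 * m ^ 2) = 2 * m + (2 * m) ^ 2 := by push_cast; ring
  rw [h4, div_le_iff₀ (by linarith), mul_comm, h5]
  exact h3

/-- The Laplace transform of a quadratic form in independent standard Gaussian variables. -/
theorem lintegral_exp_quadratic_le {κ : Type*} [Fintype κ] [DecidableEq κ]
    {S : Matrix κ κ ℝ} (hS : S.IsHermitian)
    (hle : ∀ x : κ → ℝ, |∑ k, ∑ l, x k * S k l * x l| ≤ 1 / 4 * ∑ k, x k ^ 2) :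
    ∫⁻ x, ENNReal.ofReal (Real.exp (∑ k, ∑ l, x k * S k l * x l))
        ∂Measure.pi (fun _ : κ => gaussianReal 0 1) ≤
      ENNReal.ofReal (Real.exp (∑ k, S k k + 2 * ∑ k, ∑ l, S k l ^ 2)) := by
  set b := hS.eigenvectorBasis with hb
  set μ := hS.eigenvalues with hμ
  let q : EuclideanSpace ℝ κ → ℝ := fun u => ∑ k, ∑ l, u k * S k l * u l
  have hq : ∀ u : EuclideanSpace ℝ κ, q u = u.ofLp ⬝ᵥ (S.mulVec u.ofLp) := by
    intro u
    simp [q, dotProduct, Matrix.mulVec, Finset.mul_sum, mul_assoc]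
  have hqb : ∀ y : κ → ℝ, q (∑ i, y i • b i) = ∑ i, μ i * y i ^ 2 := by
    intro y
    have h1 : S.mulVec (∑ i, y i • b i).ofLp = ∑ i, (μ i * y i) • (b i).ofLp := by
      rw [WithLp.ofLp_sum, Matrix.mulVec_sum]
      refine Finset.sum_congr rfl fun i _ => ?_
      rw [WithLp.ofLp_smul, Matrix.mulVec_smul, hS.mulVec_eigenvectorBasis, smul_smul, mul_comm]
    have h2 : q (∑ i, y i • b i) = ⟪∑ i, (μ i * y i) • b i, ∑ i, y i • b i⟫_ℝ := by
      rw [hq, h1, EuclideanSpace.inner_eq_star_dotProduct]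
      simp
    rw [h2, b.orthonormal.inner_sum]
    refine Finset.sum_congr rfl fun i _ => ?_
    simp only [conj_trivial]
    ring
  have hμ4 : ∀ i, |μ i| ≤ 1 / 4 := by
    intro i
    have h1 := hqb (Pi.single i 1)
    have h2 : ∑ j, (Pi.single i 1 : κ → ℝ) j • b j = b i := by
      rw [Finset.sum_eq_single i] <;> simp +contextual
    have h3 : ∑ j, μ j * (Pi.single i 1 : κ → ℝ) j ^ 2 = μ i := by
      rw [Finset.sum_eq_single i] <;> simp +contextual
    rw [h2, h3] at h1
    have h4 := hle (b i).ofLp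
    rw [← EuclideanSpace.real_norm_sq_eq, b.orthonormal.1] at h4
    rw [← h1]
    simpa using h4
  have htr : ∑ k, S k k = ∑ i, μ i := by
    have := hS.trace_eq_sum_eigenvalues
    simpa [Matrix.trace] using this
  have htr2 : ∑ k, ∑ l, S k l ^ 2 = ∑ i, μ i ^ 2 := by
    have h1 : ∑ k, ∑ l, S k l ^ 2 = (S * S).trace := by
      simp only [Matrix.trace, Matrix.diag, Matrix.mul_apply]
      refine Finset.sum_congr rfl fun k _ => Finset.sum_congr rfl fun l _ => ?_
      rw [sq]; congr 1
      simpa using (hS.apply k l).symm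
    have h2 : S * S = Unitary.conjStarAlgAut ℝ _ hS.eigenvectorUnitary
        (Matrix.diagonal μ * Matrix.diagonal μ) := by
      rw [map_mul]
      have := hS.spectral_theorem
      simp only [RCLike.ofReal_real_eq_id, Function.id_comp] at this
      rw [← this]
    rw [h1, h2, Unitary.conjStarAlgAut_apply, Matrix.trace_mul_cycle]
    simp [Matrix.trace, sq]
  have hqm : Measurable fun u => ENNReal.ofReal (Real.exp (q u)) := by
    fun_prop
  calc _ = ∫⁻ u, ENNReal.ofReal (Real.exp (q u)) ∂stdGaussian (EuclideanSpace ℝ κ) := by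
        rw [← map_pi_eq_stdGaussian, lintegral_map hqm (by fun_prop)]
    _ = ∫⁻ y : κ → ℝ, ENNReal.ofReal (∏ i, Real.exp (μ i * y i ^ 2))
          ∂Measure.pi (fun _ : κ => gaussianReal 0 1) := by
        -- By rotation invariance the coordinates in the eigenbasis of S are again independent
        -- standard Gaussians, so the integral factorises.
        rw [stdGaussian_eq_map_pi_orthonormalBasis b, lintegral_map hqm (by fun_prop)]
        simp only [hqb, Real.exp_sum]
    _ = ENNReal.ofReal (∏ i, ∫ x, Real.exp (μ i * x ^ 2) ∂gaussianReal 0 1) := by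
        rw [← ofReal_integral_eq_lintegral_ofReal, integral_fintype_prod_eq_prod
          (f := fun i x => Real.exp (μ i * x ^ 2))]
        · exact Integrable.fintype_prod
            (fun i => integrable_exp_mul_sq_gaussianReal (hμ4 i))
        · exact Filter.Eventually.of_forall fun y => by positivity
    _ ≤ _ := by
        refine ENNReal.ofReal_le_ofReal ?_
        rw [htr, htr2, Finset.mul_sum, ← Finset.sum_add_distrib, Real.exp_sum]
        exact Finset.prod_le_prod (fun i _ => by positivity)
          fun i _ => integral_exp_mul_sq_gaussianReal_le (hμ4 i)

/-! ### Laplace transforms for complex Gaussian vectors -/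

theorem complexGaussian_eq_map (v : ℝ≥0) :
    complexGaussian v = ((gaussianReal 0 1).prod (gaussianReal 0 1)).map
      (fun x : ℝ × ℝ => (√(v / 2) : ℂ) * (x.1 + x.2 * Complex.I)) := by
  have h : gaussianReal 0 (v / 2) = (gaussianReal 0 1).map (fun x => √(v / 2) * x) := by
    rw [gaussianReal_map_const_mul]
    congr 1
    · simp
    · ext
      have := Real.sq_sqrt (show (0 : ℝ) ≤ v / 2 by positivity)
      simpa using this.symm
  rw [complexGaussian, h, Measure.map_prod_map _ _ (by fun_prop) (by fun_prop),
    Measure.map_map (by fun_prop) (by fun_prop)]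
  congr 1
  ext x
  simp only [Function.comp, Complex.measurableEquivRealProd_symm_apply, Prod.map]
  apply Complex.ext <;> simp

theorem pi_complexGaussian_eq_map {κ : Type*} [Fintype κ] (p : κ → ℝ≥0) :
    Measure.pi (fun i => complexGaussian (p i)) =
      (Measure.pi (fun _ : κ ⊕ κ => gaussianReal 0 1)).map
        (fun x i => (√(p i / 2) : ℂ) * (x (.inl i) + x (.inr i) * Complex.I)) := by
  have h1 := (measurePreserving_sumPiEquivProdPi (X := fun _ : κ ⊕ κ => ℝ)
    (fun _ : κ ⊕ κ => gaussianReal 0 1)).map_eq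
  have h2 := (measurePreserving_arrowProdEquivProdArrow ℝ ℝ κ (fun _ => gaussianReal 0 1)
    (fun _ => gaussianReal 0 1)).symm.map_eq
  simp only [complexGaussian_eq_map]
  rw [← Measure.pi_map_pi (fun i => by fun_prop), ← h2, ← h1, Measure.map_map (by fun_prop)
    (by fun_prop), Measure.map_map (by fun_prop) (by fun_prop)]
  rfl

section

variable {H : Type*} [NormedAddCommGroup H] [InnerProductSpace ℂ H]

/-- Writing each coordinate as √(p i / 2) times a standard complex Gaussian turns the form into a
real one with twice as many variables. Its trace is ∑ p i ⟨e i, D e i⟩, and twice the square of its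
Hilbert–Schmidt norm is ∑ p i p j |⟨e i, D e j⟩|². -/
theorem lintegral_exp_inner_finset_le_of_isSymmetric {ι : Type*} (e : HilbertBasis ι ℂ H)
    {p : ι → ℝ≥0} {r : ℝ} (hr0 : 0 ≤ r) (hr : ∀ i, (p i : ℝ) ≤ r) (F : Finset ι)
    (hF : ∑ i ∈ F, (p i : ℝ) ≤ 1) (D : H →L[ℂ] H)
    (hD : ∀ x y, ⟪D x, y⟫_ℂ = ⟪x, D y⟫_ℂ) (hDr : ‖D‖ * r ≤ 1 / 2) :
    ∫⁻ z, ENNReal.ofReal (Real.exp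
        (⟪∑ i ∈ F, z i • e i, D (∑ i ∈ F, z i • e i)⟫_ℂ).re) ∂coordLaw p ≤
      ENNReal.ofReal (Real.exp
        (∑ i ∈ F, (p i : ℝ) * (⟪e i, D (e i)⟫_ℂ).re + r * ‖D‖ ^ 2)) := by
  classical
  let u : F → F → ℂ := fun i j => ⟪e i, D (e j)⟫_ℂ
  let c : F → ℝ := fun i => √(p i / 2)
  have hc : ∀ i, c i * c i = p i / 2 := fun i => Real.mul_self_sqrt (by positivity)
  have hu : ∀ i j, u j i = (starRingEnd ℂ) (u i j) := by
    intro i j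
    simp only [u]
    rw [inner_conj_symm, hD]
  -- S is the realification of the Hermitian matrix c i c j u i j, acting on the real parts (`inl`)
  -- and imaginary parts (`inr`).
  obtain ⟨S, S11, S12, S21, S22⟩ : ∃ S : Matrix (F ⊕ F) (F ⊕ F) ℝ,
      (∀ i j, S (.inl i) (.inl j) = c i * c j * (u i j).re) ∧
      (∀ i j, S (.inl i) (.inr j) = -(c i * c j * (u i j).im)) ∧
      (∀ i j, S (.inr i) (.inl j) = c i * c j * (u i j).im) ∧
      (∀ i j, S (.inr i) (.inr j) = c i * c j * (u i j).re) :=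
    ⟨Matrix.fromBlocks (fun i j => c i * c j * (u i j).re) (fun i j => -(c i * c j * (u i j).im))
      (fun i j => c i * c j * (u i j).im) (fun i j => c i * c j * (u i j).re),
      fun _ _ => rfl, fun _ _ => rfl, fun _ _ => rfl, fun _ _ => rfl⟩
  have hS : S.IsHermitian := by
    refine Matrix.IsHermitian.ext ?_
    rintro (i | i) (j | j) <;> simp only [S11, S12, S21, S22, star_trivial, hu i j,
      Complex.conj_re, Complex.conj_im] <;> ring
  let w : (F ⊕ F → ℝ) → F → ℂ := fun x i => (c i : ℂ) * (x (.inl i) + x (.inr i) * Complex.I)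
  let V : (F ⊕ F → ℝ) → H := fun x => ∑ i : F, w x i • e i
  have hV : ∀ x, (⟪V x, D (V x)⟫_ℂ).re = ∑ k, ∑ l, x k * S k l * x l := by
    intro x
    have h1 : ⟪V x, D (V x)⟫_ℂ = ∑ i, ∑ j, (starRingEnd ℂ) (w x i) * w x j * u i j := by
      simp only [V]
      rw [map_sum, sum_inner]
      refine Finset.sum_congr rfl fun i _ => ?_
      rw [inner_sum]
      refine Finset.sum_congr rfl fun j _ => ?_
      rw [map_smul, inner_smul_left, inner_smul_right]
      simp only [u]
      ring
    simp only [h1, Complex.re_sum, Fintype.sum_sum_type, S11, S12, S21, S22,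
      ← Finset.sum_add_distrib]
    refine Finset.sum_congr rfl fun i _ => Finset.sum_congr rfl fun j _ => ?_
    simp [w]
    ring
  have hVn : ∀ x, ‖V x‖ ^ 2 ≤ r / 2 * ∑ k, x k ^ 2 := by
    intro x
    have h1 : ‖V x‖ ^ 2 = ∑ i, ‖w x i‖ ^ 2 := by
      have h2 := (e.orthonormal.comp _ Subtype.val_injective).inner_sum (w x) (w x)
        (s := (Finset.univ : Finset F))
      have h3 : ⟪V x, V x⟫_ℂ = _ := h2
      have h4 : ‖V x‖ ^ 2 = (⟪V x, V x⟫_ℂ).re := by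
        rw [inner_self_eq_norm_sq_to_K]; norm_cast
      rw [h4, h3, Complex.re_sum]
      refine Finset.sum_congr rfl fun i _ => ?_
      rw [Complex.conj_mul']
      norm_cast
    rw [h1, Fintype.sum_sum_type, ← Finset.sum_add_distrib, Finset.mul_sum]
    refine Finset.sum_le_sum fun i _ => ?_
    have h4 : ‖w x i‖ ^ 2 = c i * c i * (x (.inl i) ^ 2 + x (.inr i) ^ 2) := by
      rw [Complex.sq_norm, Complex.normSq_apply]
      simp [w]
      ring
    rw [h4, hc]
    have := hr i
    gcongr
  have hle : ∀ x : F ⊕ F → ℝ, |∑ k, ∑ l, x k * S k l * x l| ≤ 1 / 4 * ∑ k, x k ^ 2 := by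
    intro x
    rw [← hV]
    have hx : 0 ≤ ∑ k, x k ^ 2 := Finset.sum_nonneg fun _ _ => sq_nonneg _
    calc |(⟪V x, D (V x)⟫_ℂ).re| ≤ ‖⟪V x, D (V x)⟫_ℂ‖ := Complex.abs_re_le_norm _
      _ ≤ ‖V x‖ * (‖D‖ * ‖V x‖) := (norm_inner_le_norm _ _).trans (by gcongr; exact D.le_opNorm _)
      _ = ‖D‖ * ‖V x‖ ^ 2 := by ring
      _ ≤ ‖D‖ * (r / 2 * ∑ k, x k ^ 2) := by gcongr; exact hVn x
      _ = ‖D‖ * r * (∑ k, x k ^ 2) / 2 := by ring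
      _ ≤ 1 / 2 * (∑ k, x k ^ 2) / 2 := by gcongr
      _ = _ := by ring
  have htr : ∑ k, S k k = ∑ i ∈ F, (p i : ℝ) * (⟪e i, D (e i)⟫_ℂ).re := by
    rw [← Finset.sum_coe_sort F, Fintype.sum_sum_type, ← Finset.sum_add_distrib]
    refine Finset.sum_congr rfl fun i _ => ?_
    rw [S11, S22, hc]
    ring
  have htr2 : 2 * ∑ k, ∑ l, S k l ^ 2 ≤ r * ‖D‖ ^ 2 := by
    have h1 : ∑ k, ∑ l, S k l ^ 2 = ∑ j : F, ∑ i : F, (p i * p j / 2 : ℝ) * ‖u i j‖ ^ 2 := by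
      rw [Finset.sum_comm (s := (Finset.univ : Finset F))]
      simp only [Fintype.sum_sum_type, S11, S12, S21, S22, ← Finset.sum_add_distrib]
      refine Finset.sum_congr rfl fun i _ => Finset.sum_congr rfl fun j _ => ?_
      rw [Complex.sq_norm, Complex.normSq_apply]
      linear_combination 2 * ((u i j).re ^ 2 + (u i j).im ^ 2) *
        (c j * c j * hc i + p i / 2 * hc j)
    -- One weight p i is estimated by r, and Bessel's inequality bounds the sum over i; the other
    -- weight p j is kept because the p j sum to at most 1.
    have h2 : ∀ j : F, ∑ i : F, (p i * p j / 2 : ℝ) * ‖u i j‖ ^ 2 ≤ r * ‖D‖ ^ 2 / 2 * p j := by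
      intro j
      have h3 : ∑ i : F, ‖u i j‖ ^ 2 ≤ ‖D‖ ^ 2 := by
        refine ((e.orthonormal.comp _ Subtype.val_injective).sum_inner_products_le
          (D (e j)) (s := (Finset.univ : Finset F))).trans ?_
        have h4 := D.le_opNorm (e j)
        rw [e.orthonormal.1, mul_one] at h4
        gcongr
      calc ∑ i : F, (p i * p j / 2 : ℝ) * ‖u i j‖ ^ 2
          ≤ ∑ i : F, (r * p j / 2 : ℝ) * ‖u i j‖ ^ 2 := by
            refine Finset.sum_le_sum fun i _ => ?_
            have := hr i
            gcongr
        _ = (r * p j / 2 : ℝ) * ∑ i : F, ‖u i j‖ ^ 2 := by rw [Finset.mul_sum]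
        _ ≤ (r * p j / 2 : ℝ) * ‖D‖ ^ 2 := by
            gcongr
        _ = _ := by ring
    calc 2 * ∑ k, ∑ l, S k l ^ 2 ≤ 2 * ∑ j : F, r * ‖D‖ ^ 2 / 2 * p j := by
          rw [h1]
          gcongr with j
          exact h2 j
      _ = r * ‖D‖ ^ 2 * ∑ j : F, (p j : ℝ) := by rw [← Finset.mul_sum]; ring
      _ ≤ r * ‖D‖ ^ 2 * 1 := by
          gcongr
          rwa [Finset.sum_coe_sort F fun j => (p j : ℝ)]
      _ = _ := mul_one _
  calc _ = ∫⁻ x, ENNReal.ofReal (Real.exp (∑ k, ∑ l, x k * S k l * x l))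
        ∂Measure.pi (fun _ : F ⊕ F => gaussianReal 0 1) := by
        -- The integrand only sees the coordinates in F, so the infinite product measure may be
        -- replaced by its finite marginal.
        have h1 : (Measure.infinitePi fun i => complexGaussian (p i)).map F.restrict = _ :=
          Measure.infinitePi_map_restrict _
        have h2 := pi_complexGaussian_eq_map (fun i : F => p i)
        rw [← h1] at h2
        let G : (F → ℂ) → ℝ≥0∞ := fun w => ENNReal.ofReal (Real.exp
          (⟪∑ i, w i • e i, D (∑ i, w i • e i)⟫_ℂ).re)
        have hG : Measurable G :=
          (ENNReal.continuous_ofReal.comp (by fun_prop)).measurable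
        have h3 : ∀ z : ι → ℂ, ∑ i ∈ F, z i • e i = ∑ i, F.restrict z i • e i := by
          intro z
          rw [← Finset.sum_coe_sort F]
          rfl
        simp only [h3]
        have h4 := lintegral_map hG (Finset.measurable_restrict (X := fun _ => ℂ) F) (μ := coordLaw p)
        rw [← h4, coordLaw, h2, lintegral_map hG (by fun_prop)]
        simp only [← hV]
        rfl
    _ ≤ _ := lintegral_exp_quadratic_le hS hle
    _ ≤ _ := by
        rw [htr]
        gcongr

/-- Only the self-adjoint part (D + D^*)/2 contributes to Re⟨x, Dx⟩, and its norm is at most ‖D‖. -/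
theorem lintegral_exp_inner_finset_le {ι : Type*} [CompleteSpace H] (e : HilbertBasis ι ℂ H)
    {p : ι → ℝ≥0} {r : ℝ} (hr0 : 0 ≤ r) (hr : ∀ i, (p i : ℝ) ≤ r) (F : Finset ι)
    (hF : ∑ i ∈ F, (p i : ℝ) ≤ 1) (D : H →L[ℂ] H) (hDr : ‖D‖ * r ≤ 1 / 2) :
    ∫⁻ z, ENNReal.ofReal (Real.exp
        (⟪∑ i ∈ F, z i • e i, D (∑ i ∈ F, z i • e i)⟫_ℂ).re) ∂coordLaw p ≤
      ENNReal.ofReal (Real.exp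
        (∑ i ∈ F, (p i : ℝ) * (⟪e i, D (e i)⟫_ℂ).re + r * ‖D‖ ^ 2)) := by
  let A : H →L[ℂ] H := ((1 / 2 : ℝ) : ℂ) • (D + star D)
  have hA : ∀ x, (⟪x, A x⟫_ℂ).re = (⟪x, D x⟫_ℂ).re := by
    intro x
    have h1 : ⟪x, star D x⟫_ℂ = (starRingEnd ℂ) ⟪x, D x⟫_ℂ := by
      rw [ContinuousLinearMap.star_eq_adjoint, ContinuousLinearMap.adjoint_inner_right,
        inner_conj_symm]
    simp only [A, _root_.smul_apply, _root_.add_apply, inner_smul_right, inner_add_right, h1,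
      Complex.add_conj]
    simp
  have hAs : ∀ x y, ⟪A x, y⟫_ℂ = ⟪x, A y⟫_ℂ := by
    intro x y
    simp only [A, _root_.smul_apply, _root_.add_apply, inner_smul_right, inner_add_right,
      inner_smul_left, inner_add_left, ContinuousLinearMap.star_eq_adjoint,
      ContinuousLinearMap.adjoint_inner_right, ContinuousLinearMap.adjoint_inner_left,
      Complex.conj_ofReal, add_comm]
  have hAn : ‖A‖ ≤ ‖D‖ := by
    have h1 := norm_add_le D (star D)
    rw [norm_star] at h1
    rw [norm_smul]
    norm_num
    linarith
  have h := lintegral_exp_inner_finset_le_of_isSymmetric e hr0 hr F hF A hAs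
    ((mul_le_mul_of_nonneg_right hAn hr0).trans hDr)
  simp only [hA] at h
  refine h.trans ?_
  gcongr

/-- The finite truncations converge almost surely and their bounds converge, so Fatou's lemma passes
to the limit. -/
theorem lintegral_exp_inner_gaussianVector_le {ι : Type*} [Countable ι] [CompleteSpace H]
    [TopologicalSpace.SeparableSpace H] (e : HilbertBasis ι ℂ H)
    {p : ι → ℝ≥0} (hp : ∑' i, (p i : ℝ≥0∞) = 1) {r : ℝ} (hr : ∀ i, (p i : ℝ) ≤ r)
    (D : H →L[ℂ] H) (hDr : ‖D‖ * r ≤ 1 / 2) {b : ℝ}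
    (hb : HasSum (fun i => (p i : ℝ) * (⟪e i, D (e i)⟫_ℂ).re) b) :
    ∫⁻ z, ENNReal.ofReal (Real.exp
        (⟪gaussianVector e z, D (gaussianVector e z)⟫_ℂ).re) ∂coordLaw p ≤
      ENNReal.ofReal (Real.exp (b + r * ‖D‖ ^ 2)) := by
  have hp' : ∑' i, (p i : ℝ≥0∞) ≠ ∞ := by simp [hp]
  have hne : Nonempty ι := by
    by_contra h
    rw [not_nonempty_iff] at h
    simp at hp
  have hr0 : 0 ≤ r := (NNReal.coe_nonneg _).trans (hr hne.some)
  have hF : ∀ F : Finset ι, ∑ i ∈ F, (p i : ℝ) ≤ 1 := by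
    intro F
    have h := ENNReal.sum_le_tsum (f := fun i => (p i : ℝ≥0∞)) F
    rw [hp] at h
    exact_mod_cast h
  let f : Finset ι → (ι → ℂ) → ℝ≥0∞ := fun F z => ENNReal.ofReal (Real.exp
    (⟪∑ i ∈ F, z i • e i, D (∑ i ∈ F, z i • e i)⟫_ℂ).re)
  have hf : ∀ F, AEMeasurable (f F) (coordLaw p) := by
    intro F
    exact (ENNReal.continuous_ofReal.comp (by fun_prop)).measurable.aemeasurable
  calc _ = ∫⁻ z, Filter.liminf (fun F => f F z) Filter.atTop ∂coordLaw p := by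
        refine lintegral_congr_ae ?_
        filter_upwards [ae_hasSum_gaussianVector e hp'] with z hz
        refine (Filter.Tendsto.liminf_eq ?_).symm
        refine (ENNReal.continuous_ofReal.comp (f := fun y : H => Real.exp (⟪y, D y⟫_ℂ).re)
          (by fun_prop)).continuousAt.tendsto.comp hz
    _ ≤ Filter.liminf (fun F => ∫⁻ z, f F z ∂coordLaw p) Filter.atTop := lintegral_liminf_le' hf
    _ ≤ Filter.liminf (fun F : Finset ι => ENNReal.ofReal (Real.exp
          (∑ i ∈ F, (p i : ℝ) * (⟪e i, D (e i)⟫_ℂ).re + r * ‖D‖ ^ 2))) Filter.atTop :=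
        Filter.liminf_le_liminf (Filter.Eventually.of_forall fun F =>
          lintegral_exp_inner_finset_le e hr0 hr F (hF F) D hDr)
    _ = _ := by
        refine Filter.Tendsto.liminf_eq ?_
        exact (ENNReal.continuous_ofReal.comp
          (f := fun y : ℝ => Real.exp (y + r * ‖D‖ ^ 2)) (by fun_prop)).continuousAt.tendsto.comp hb

end

/-! ### Exponential moments under GAP -/

section

variable {H : Type*} [NormedAddCommGroup H] [InnerProductSpace ℂ H]

/-- Unfolds normalisation and density into an integral over Gaussian coordinates. The restriction to
the sphere is simply dropped, which is harmless for an upper bound. -/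
theorem lintegral_scroogeMeasure_le [CompleteSpace H] [TopologicalSpace.SeparableSpace H]
    [MeasurableSpace H] [BorelSpace H] {ι : Type*} [Countable ι] (e : HilbertBasis ι ℂ H)
    {p : ι → ℝ≥0} (hp : ∑' i, (p i : ℝ≥0∞) = 1) {f : H → ℝ≥0∞} (hf : Measurable f) :
    ∫⁻ ψ, f ψ ∂scroogeMeasure e p ≤
      ∫⁻ z, ENNReal.ofReal (‖gaussianVector e z‖ ^ 2) *
        f ((‖gaussianVector e z‖ : ℂ)⁻¹ • gaussianVector e z) ∂coordLaw p := by
  have := UniformSpace.secondCountable_of_separable H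
  have hm : Measurable fun ψ : H => (‖ψ‖ : ℂ)⁻¹ • ψ := by fun_prop
  have hS : MeasurableSet (Metric.sphere (0 : H) 1) := Metric.isClosed_sphere.measurableSet
  have hp' : ∑' i, (p i : ℝ≥0∞) ≠ ∞ := by simp [hp]
  rw [scroogeMeasure, lintegral_subtype_comap hS]
  refine (setLIntegral_le_lintegral _ _).trans ?_
  rw [lintegral_map hf hm, adjustedGaussianMeasure,
    lintegral_withDensity_eq_lintegral_mul _ (by fun_prop)
      (show Measurable fun ψ : H => f ((‖ψ‖ : ℂ)⁻¹ • ψ) from hf.comp hm), gaussianMeasure,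
    lintegral_map' (by fun_prop) (aemeasurable_gaussianVector e hp')]
  rfl

/-- Here N stands for ‖Ψ‖² and Q for a centred quadratic form. If N ≥ 1/2, then Q/N ≤ max(0, 2Q) and
N ≤ exp(N − 1), which gives the first two terms. If N < 1/2, then Q/N ≤ 2 and exp(θ/2 − θN) ≥ 1,
which gives the third: a Chernoff factor for the lower tail of N. -/
theorem mul_exp_div_le {N Q s θ : ℝ} (hN : 0 < N) (hQ : |Q| ≤ 2 * N) (hs : 0 ≤ s) (hθ : 0 ≤ θ) :
    N * Real.exp (s * (Q / N)) ≤ Real.exp (-1) * Real.exp N +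
      Real.exp (-1) * Real.exp (N + 2 * s * Q) +
      1 / 2 * Real.exp (2 * s + θ / 2) * Real.exp (-θ * N) := by
  have hNe : N ≤ Real.exp (-1) * Real.exp N := by
    rw [← Real.exp_add]
    have := Real.add_one_le_exp (-1 + N)
    linarith
  obtain ⟨hQ1, hQ2⟩ := abs_le.1 hQ
  rcases lt_or_ge N (1 / 2) with h | h
  · have h1 : Q / N ≤ 2 := by rw [div_le_iff₀ hN]; linarith
    have h2 : N * Real.exp (s * (Q / N)) ≤
        1 / 2 * Real.exp (2 * s + θ / 2) * Real.exp (-θ * N) := by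
      rw [mul_assoc, ← Real.exp_add]
      gcongr
      nlinarith
    have h3 : 0 ≤ Real.exp (-1) * Real.exp N := by positivity
    have h4 : 0 ≤ Real.exp (-1) * Real.exp (N + 2 * s * Q) := by positivity
    linarith
  · have h3 : 0 ≤ 1 / 2 * Real.exp (2 * s + θ / 2) * Real.exp (-θ * N) := by positivity
    rcases le_total Q 0 with hQ0 | hQ0
    · have h1 : Real.exp (s * (Q / N)) ≤ 1 := by
        rw [Real.exp_le_one_iff]
        exact mul_nonpos_of_nonneg_of_nonpos hs (div_nonpos_of_nonpos_of_nonneg hQ0 hN.le)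
      have h4 : 0 ≤ Real.exp (-1) * Real.exp (N + 2 * s * Q) := by positivity
      nlinarith
    · have h1 : Q / N ≤ 2 * Q := by rw [div_le_iff₀ hN]; nlinarith
      have h2 : N * Real.exp (s * (Q / N)) ≤ Real.exp (-1) * Real.exp (N + 2 * s * Q) := by
        rw [Real.exp_add, ← mul_assoc]
        have h5 := mul_le_mul_of_nonneg_left h1 hs
        exact mul_le_mul hNe (Real.exp_le_exp.2 (by linarith)) (by positivity) (by positivity)
      have h4 : 0 ≤ Real.exp (-1) * Real.exp N := by positivity
      linarith

theorem hasSum_coe_of_tsum_eq_one {ι : Type*} {p : ι → ℝ≥0} (hp : ∑' i, (p i : ℝ≥0∞) = 1) :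
    HasSum (fun i => (p i : ℝ)) 1 := by
  have h : HasSum (fun i => (p i : ℝ≥0∞)) ((1 : ℝ≥0) : ℝ≥0∞) := by
    rw [ENNReal.coe_one, ← hp]
    exact ENNReal.summable.hasSum
  exact NNReal.hasSum_coe.2 (ENNReal.hasSum_coe.1 h)

/-- Exponential moments of `⟪ψ, B ψ⟫ - tr (ρ B)` under `GAP`. -/
theorem lintegral_exp_re_scroogeMeasure_le [CompleteSpace H] [TopologicalSpace.SeparableSpace H]
    [MeasurableSpace H] [BorelSpace H] {ι : Type*} [Countable ι] (e : HilbertBasis ι ℂ H)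
    {p : ι → ℝ≥0} (hp : ∑' i, (p i : ℝ≥0∞) = 1) {r : ℝ} (hr0 : 0 < r) (hr1 : r ≤ 1 / 10)
    (hr : ∀ i, (p i : ℝ) ≤ r) {B : H →L[ℂ] H} (hB : ‖B‖ ≤ 1) {b : ℂ}
    (hb : HasSum (fun i => (p i : ℂ) * ⟪e i, B (e i)⟫_ℂ) b) {s : ℝ} (hs0 : 0 ≤ s)
    (hs : s ≤ 1 / (32 * r)) :
    ∫⁻ ψ, ENNReal.ofReal (Real.exp (s * (⟪(ψ : H), B ψ⟫_ℂ - b).re)) ∂scroogeMeasure e p ≤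
      ENNReal.ofReal (5 / 2 * Real.exp (2 * r + 32 * r * s ^ 2)) := by
  have hps := hasSum_coe_of_tsum_eq_one hp
  have hbn : ‖b‖ ≤ 1 := by
    rw [← hb.tsum_eq]
    refine tsum_of_norm_bounded hps fun i => ?_
    rw [norm_mul]
    have h1 := (norm_inner_le_norm (𝕜 := ℂ) (e i) (B (e i))).trans
      (mul_le_mul_of_nonneg_left (B.le_opNorm _) (norm_nonneg _))
    rw [e.orthonormal.1, one_mul, mul_one] at h1
    calc ‖(p i : ℂ)‖ * ‖⟪e i, B (e i)⟫_ℂ‖ ≤ ‖(p i : ℂ)‖ * 1 := by gcongr; exact h1.trans hB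
      _ = p i := by simp
  -- Subtracting b centres the form: tr(ρD) = 0, and on unit vectors ⟨ψ, Dψ⟩ is the deviation
  -- itself. The price is ‖D‖ ≤ 2.
  let D : H →L[ℂ] H := B - b • 1
  have hone : ‖(1 : H →L[ℂ] H)‖ ≤ 1 := ContinuousLinearMap.norm_id_le
  have hD : ‖D‖ ≤ 2 := by
    calc ‖D‖ ≤ ‖B‖ + ‖b‖ * ‖(1 : H →L[ℂ] H)‖ := (norm_sub_le _ _).trans (by rw [norm_smul])
      _ ≤ 1 + 1 * 1 := by gcongr
      _ = 2 := by norm_num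
  have hDx : ∀ x, ⟪x, D x⟫_ℂ = ⟪x, B x⟫_ℂ - b * (‖x‖ : ℂ) ^ 2 := by
    intro x
    simp only [D, _root_.sub_apply, _root_.smul_apply, inner_sub_right, inner_smul_right,
      one_apply_eq_self, inner_self_eq_norm_sq_to_K]
    rfl
  have hDsum : HasSum (fun i => (p i : ℝ) * (⟪e i, D (e i)⟫_ℂ).re) 0 := by
    have h1 := Complex.hasSum_re hb
    have h2 := h1.sub (hps.mul_right b.re)
    rw [one_mul, sub_self] at h2
    have h3 : ∀ i, (p i : ℝ) * (⟪e i, D (e i)⟫_ℂ).re =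
        ((p i : ℂ) * ⟪e i, B (e i)⟫_ℂ).re - (p i : ℝ) * b.re := by
      intro i
      rw [hDx, e.orthonormal.1, Complex.re_ofReal_mul]
      simp
      ring
    simpa only [h3] using h2
  -- This θ makes rθ² = θ/4, so the third exponent becomes 2s − θ/4, which is nonpositive precisely
  -- because s ≤ 1/(32r) = θ/8.
  set θ : ℝ := 1 / (4 * r) with hθ
  have hθ0 : 0 ≤ θ := by positivity
  let Ψ := gaussianVector e
  let N : (ι → ℂ) → ℝ := fun z => ‖Ψ z‖ ^ 2
  let Q : (ι → ℂ) → ℝ := fun z => (⟪Ψ z, D (Ψ z)⟫_ℂ).re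
  have hN1 : ∀ a : ℝ, ∀ x : H, (⟪x, ((a : ℂ) • (1 : H →L[ℂ] H)) x⟫_ℂ).re = a * ‖x‖ ^ 2 := by
    intro a x
    rw [_root_.smul_apply, one_apply_eq_self, inner_smul_right, inner_self_eq_norm_sq_to_K,
      Complex.re_ofReal_mul]
    norm_cast
  have hsum1 : ∀ a : ℝ, HasSum (fun i => (p i : ℝ) *
      (⟪e i, ((a : ℂ) • (1 : H →L[ℂ] H)) (e i)⟫_ℂ).re) a := by
    intro a
    simp only [hN1, e.orthonormal.1]
    simpa using hps.mul_right a
  have hna : ∀ a : ℝ, ‖((a : ℂ) • (1 : H →L[ℂ] H))‖ ≤ |a| := by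
    intro a
    rw [norm_smul]
    simpa using mul_le_mul_of_nonneg_left hone (abs_nonneg a)
  have hr0' : ∀ a : ℝ, |a| * r ≤ 1 / 2 → ∫⁻ z, ENNReal.ofReal (Real.exp (a * N z)) ∂coordLaw p
      ≤ ENNReal.ofReal (Real.exp (a + r * a ^ 2)) := by
    intro a ha
    have h := lintegral_exp_inner_gaussianVector_le e hp hr ((a : ℂ) • 1)
      ((mul_le_mul_of_nonneg_right (hna a) hr0.le).trans ha) (hsum1 a)
    simp only [hN1] at h
    refine h.trans ?_
    rw [← sq_abs a]
    gcongr
    exact hna a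
  have hI2 : ∫⁻ z, ENNReal.ofReal (Real.exp (N z + 2 * s * Q z)) ∂coordLaw p
      ≤ ENNReal.ofReal (Real.exp (1 + r * (1 + 4 * s) ^ 2)) := by
    let A : H →L[ℂ] H := ((1 : ℝ) : ℂ) • 1 + ((2 * s : ℝ) : ℂ) • D
    have hA : ‖A‖ ≤ 1 + 4 * s := by
      calc ‖A‖ ≤ |(1 : ℝ)| + ‖((2 * s : ℝ) : ℂ)‖ * ‖D‖ :=
            (norm_add_le _ _).trans (add_le_add (hna 1) (norm_smul _ _).le)
        _ ≤ 1 + 2 * s * 2 := by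
            rw [Complex.norm_real, Real.norm_of_nonneg (by positivity), abs_one]
            gcongr
        _ = _ := by ring
    have hAx : ∀ x, (⟪x, A x⟫_ℂ).re = ‖x‖ ^ 2 + 2 * s * (⟪x, D x⟫_ℂ).re := by
      intro x
      rw [show A x = (((1 : ℝ) : ℂ) • (1 : H →L[ℂ] H)) x + ((2 * s : ℝ) : ℂ) • D x from rfl,
        inner_add_right, inner_smul_right, Complex.add_re, hN1, Complex.re_ofReal_mul, one_mul]
    have hsr : s * r ≤ 1 / 32 := by
      rw [le_div_iff₀ (by positivity)] at hs
      linarith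
    have h := lintegral_exp_inner_gaussianVector_le e hp hr A
      ((mul_le_mul_of_nonneg_right hA hr0.le).trans (by nlinarith)) (b := 1) (by
        simp only [hAx, e.orthonormal.1, mul_add]
        have h1 := hps.add (hDsum.mul_left (2 * s))
        rw [mul_zero, add_zero] at h1
        convert h1 using 2 with i
        ring)
    simp only [hAx] at h
    refine h.trans ?_
    gcongr
  have hmΨ : AEMeasurable Ψ (coordLaw p) := aemeasurable_gaussianVector e (by simp [hp])
  have hmN : AEMeasurable N (coordLaw p) := hmΨ.norm.pow_const 2
  have hmQ : AEMeasurable Q (coordLaw p) :=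
    (show Continuous fun x : H => (⟪x, D x⟫_ℂ).re by fun_prop).measurable.comp_aemeasurable hmΨ
  calc _ ≤ ∫⁻ z, ENNReal.ofReal (‖gaussianVector e z‖ ^ 2) * ENNReal.ofReal (Real.exp (s *
        (⟪(‖gaussianVector e z‖ : ℂ)⁻¹ • gaussianVector e z,
          B ((‖gaussianVector e z‖ : ℂ)⁻¹ • gaussianVector e z)⟫_ℂ - b).re)) ∂coordLaw p :=
        lintegral_scroogeMeasure_le e hp (f := fun ψ : H =>
          ENNReal.ofReal (Real.exp (s * (⟪(ψ : H), B ψ⟫_ℂ - b).re)))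
          (ENNReal.continuous_ofReal.comp (by fun_prop)).measurable
    _ ≤ ∫⁻ z, (ENNReal.ofReal (Real.exp (-1)) * ENNReal.ofReal (Real.exp (1 * N z)) +
          ENNReal.ofReal (Real.exp (-1)) * ENNReal.ofReal (Real.exp (N z + 2 * s * Q z)) +
          ENNReal.ofReal (1 / 2 * Real.exp (2 * s + θ / 2)) *
            ENNReal.ofReal (Real.exp (-θ * N z))) ∂coordLaw p := by
        refine lintegral_mono fun z => ?_
        rcases eq_or_ne (Ψ z) 0 with h0 | h0
        · change ENNReal.ofReal (‖Ψ z‖ ^ 2) * _ ≤ _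
          simp [h0]
        have hN : 0 < N z := by positivity
        have hX : (⟪(‖Ψ z‖ : ℂ)⁻¹ • Ψ z, B ((‖Ψ z‖ : ℂ)⁻¹ • Ψ z)⟫_ℂ - b).re = Q z / N z := by
          have h1 : (‖Ψ z‖ : ℂ) ≠ 0 := by simpa using h0
          have h2 : ⟪(‖Ψ z‖ : ℂ)⁻¹ • Ψ z, B ((‖Ψ z‖ : ℂ)⁻¹ • Ψ z)⟫_ℂ - b =
              ⟪Ψ z, D (Ψ z)⟫_ℂ / ((N z : ℝ) : ℂ) := by
            rw [hDx, map_smul, inner_smul_left, inner_smul_right, ← Complex.ofReal_inv,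
              Complex.conj_ofReal]
            simp only [N]
            push_cast
            field_simp
          rw [h2, Complex.div_ofReal_re]
        have hQ : |Q z| ≤ 2 * N z := by
          calc |Q z| ≤ ‖⟪Ψ z, D (Ψ z)⟫_ℂ‖ := Complex.abs_re_le_norm _
            _ ≤ ‖Ψ z‖ * (‖D‖ * ‖Ψ z‖) :=
              (norm_inner_le_norm _ _).trans (by gcongr; exact D.le_opNorm _)
            _ ≤ ‖Ψ z‖ * (2 * ‖Ψ z‖) := by gcongr
            _ = 2 * N z := by simp only [N]; ring
        have := mul_exp_div_le hN hQ hs0 hθ0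
        change ENNReal.ofReal (N z) * ENNReal.ofReal (Real.exp (s *
          (⟪(‖Ψ z‖ : ℂ)⁻¹ • Ψ z, B ((‖Ψ z‖ : ℂ)⁻¹ • Ψ z)⟫_ℂ - b).re)) ≤ _
        rw [hX, one_mul]
        rw [← ENNReal.ofReal_mul (by positivity), ← ENNReal.ofReal_mul (by positivity),
          ← ENNReal.ofReal_mul (by positivity), ← ENNReal.ofReal_mul (by positivity),
          ← ENNReal.ofReal_add (by positivity) (by positivity),
          ← ENNReal.ofReal_add (by positivity) (by positivity)]
        exact ENNReal.ofReal_le_ofReal this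
    _ = ENNReal.ofReal (Real.exp (-1)) * (∫⁻ z, ENNReal.ofReal (Real.exp (1 * N z)) ∂coordLaw p) +
          ENNReal.ofReal (Real.exp (-1)) *
            (∫⁻ z, ENNReal.ofReal (Real.exp (N z + 2 * s * Q z)) ∂coordLaw p) +
          ENNReal.ofReal (1 / 2 * Real.exp (2 * s + θ / 2)) *
            ∫⁻ z, ENNReal.ofReal (Real.exp (-θ * N z)) ∂coordLaw p := by
        rw [lintegral_add_left' (by fun_prop), lintegral_add_left' (by fun_prop),
          lintegral_const_mul' _ _ ENNReal.ofReal_ne_top,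
          lintegral_const_mul' _ _ ENNReal.ofReal_ne_top,
          lintegral_const_mul' _ _ ENNReal.ofReal_ne_top]
    _ ≤ ENNReal.ofReal (Real.exp (-1)) * ENNReal.ofReal (Real.exp (1 + r * 1 ^ 2)) +
          ENNReal.ofReal (Real.exp (-1)) * ENNReal.ofReal (Real.exp (1 + r * (1 + 4 * s) ^ 2)) +
          ENNReal.ofReal (1 / 2 * Real.exp (2 * s + θ / 2)) *
            ENNReal.ofReal (Real.exp (-θ + r * (-θ) ^ 2)) := by
        gcongr
        · exact hr0' 1 (by rw [abs_one]; linarith)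
        · refine hr0' (-θ) ?_
          rw [abs_neg, abs_of_nonneg hθ0, hθ]
          field_simp
          norm_num
    _ ≤ _ := by
        rw [← ENNReal.ofReal_mul (by positivity), ← ENNReal.ofReal_mul (by positivity),
          ← ENNReal.ofReal_mul (by positivity),
          ← ENNReal.ofReal_add (by positivity) (by positivity),
          ← ENNReal.ofReal_add (by positivity) (by positivity)]
        refine ENNReal.ofReal_le_ofReal ?_
        rw [mul_assoc (1 / 2 : ℝ), ← Real.exp_add, ← Real.exp_add, ← Real.exp_add]
        have hrθ : r * θ = 1 / 4 := by rw [hθ]; field_simp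
        have h1 : -1 + (1 + r * 1 ^ 2) ≤ 2 * r + 32 * r * s ^ 2 := by
          have : 0 ≤ r * s ^ 2 := by positivity
          linarith
        -- This uses (1 + 4s)² ≤ 2 + 32s². All three terms then share one exponent, and their
        -- coefficients 1, 1 and 1/2 add up to 5/2.
        have h2 : -1 + (1 + r * (1 + 4 * s) ^ 2) ≤ 2 * r + 32 * r * s ^ 2 := by
          have : 0 ≤ r * (1 - 4 * s) ^ 2 := by positivity
          linarith
        have h3 : 2 * s + θ / 2 + (-θ + r * (-θ) ^ 2) ≤ 2 * r + 32 * r * s ^ 2 := by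
          have h4 : r * (-θ) ^ 2 = θ / 4 := by linear_combination θ * hrθ
          have h5 : 1 / (32 * r) = θ / 8 := by rw [hθ]; field_simp; norm_num
          have h6 : 0 ≤ r * s ^ 2 := by positivity
          rw [h4]
          linarith
        have e1 := Real.exp_le_exp.2 h1
        have e2 := Real.exp_le_exp.2 h2
        have e3 := Real.exp_le_exp.2 h3
        have aux : ∀ {w x y z : ℝ}, x ≤ w → y ≤ w → z ≤ w → x + y + 1 / 2 * z ≤ 5 / 2 * w := by
          intro w x y z _ _ _
          linarith
        exact aux e1 e2 e3

/-- Since |x| ≤ |Re x| + |Im x|, the exponential is at most a product, and the arithmetic–geometric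
mean inequality separates the two factors at the price of doubling s. The four terms are real parts
of rotations of x, so the bound for real parts applies to each. -/
theorem exp_norm_le {s : ℝ} (hs : 0 ≤ s) (x : ℂ) :
    Real.exp (s * ‖x‖) ≤ 1 / 2 * (Real.exp (2 * s * x.re) + Real.exp (2 * s * (-1 * x).re) +
      Real.exp (2 * s * (Complex.I * x).re) + Real.exp (2 * s * (-Complex.I * x).re)) := by
  have h1 : ‖x‖ ≤ |x.re| + |x.im| := Complex.norm_le_abs_re_add_abs_im x
  have h2 : Real.exp (s * ‖x‖) ≤ Real.exp (s * |x.re|) * Real.exp (s * |x.im|) := by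
    rw [← Real.exp_add, ← mul_add]
    gcongr
  have h3 : ∀ y : ℝ, Real.exp (s * |y|) ^ 2 ≤ Real.exp (2 * s * y) + Real.exp (2 * s * (-y)) := by
    intro y
    rw [← Real.exp_nat_mul]
    have := Real.exp_pos (2 * s * y)
    have := Real.exp_pos (2 * s * (-y))
    rcases abs_cases y with ⟨h, -⟩ | ⟨h, -⟩ <;> rw [h] <;> push_cast <;>
      rw [← mul_assoc] <;> linarith
  have h4 := h3 x.re
  have h5 := h3 x.im
  have h6 := two_mul_le_add_sq (Real.exp (s * |x.re|)) (Real.exp (s * |x.im|))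
  simp only [neg_mul, one_mul, Complex.neg_re, Complex.I_mul_re, neg_neg]
  linarith

/-- The real-part bound is applied at 2s to cB for c = ±1, ±i, which are still contractions. Half of
four times 5/2 gives the factor 5. -/
theorem lintegral_exp_norm_scroogeMeasure_le [CompleteSpace H] [TopologicalSpace.SeparableSpace H]
    [MeasurableSpace H] [BorelSpace H] {ι : Type*} [Countable ι] (e : HilbertBasis ι ℂ H)
    {p : ι → ℝ≥0} (hp : ∑' i, (p i : ℝ≥0∞) = 1) {r : ℝ} (hr0 : 0 < r) (hr1 : r ≤ 1 / 10)
    (hr : ∀ i, (p i : ℝ) ≤ r) {B : H →L[ℂ] H} (hB : ‖B‖ ≤ 1) {b : ℂ}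
    (hb : HasSum (fun i => (p i : ℂ) * ⟪e i, B (e i)⟫_ℂ) b) {s : ℝ} (hs0 : 0 ≤ s)
    (hs : s ≤ 1 / (64 * r)) :
    ∫⁻ ψ, ENNReal.ofReal (Real.exp (s * ‖⟪(ψ : H), B ψ⟫_ℂ - b‖)) ∂scroogeMeasure e p ≤
      ENNReal.ofReal (5 * Real.exp (2 * r + 128 * r * s ^ 2)) := by
  have key : ∀ c : ℂ, ‖c‖ ≤ 1 →
      ∫⁻ ψ, ENNReal.ofReal (Real.exp (2 * s * (c * (⟪(ψ : H), B ψ⟫_ℂ - b)).re))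
        ∂scroogeMeasure e p ≤ ENNReal.ofReal (5 / 2 * Real.exp (2 * r + 128 * r * s ^ 2)) := by
    intro c hc
    have h := lintegral_exp_re_scroogeMeasure_le e hp hr0 hr1 hr (B := c • B) (b := c * b)
      (s := 2 * s) ?_ ?_ (by positivity) ?_
    · simp only [_root_.smul_apply, inner_smul_right, ← mul_sub] at h
      refine h.trans_eq ?_
      congr 4
      ring
    · rw [norm_smul]
      exact mul_le_one₀ hc (norm_nonneg _) hB
    · simp only [_root_.smul_apply, inner_smul_right, mul_left_comm _ c]
      exact hb.mul_left c
    · calc 2 * s ≤ 2 * (1 / (64 * r)) := by gcongr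
        _ = _ := by field_simp; norm_num
  have hm : ∀ c : ℂ, Measurable fun ψ : Metric.sphere (0 : H) 1 =>
      ENNReal.ofReal (Real.exp (2 * s * (c * (⟪(ψ : H), B ψ⟫_ℂ - b)).re)) := fun c =>
    (ENNReal.continuous_ofReal.comp (by fun_prop)).measurable
  set K := ENNReal.ofReal (5 / 2 * Real.exp (2 * r + 128 * r * s ^ 2)) with hK
  calc _ ≤ ∫⁻ ψ : Metric.sphere (0 : H) 1, ENNReal.ofReal (1 / 2) *
        (ENNReal.ofReal (Real.exp (2 * s * (1 * (⟪(ψ : H), B ψ⟫_ℂ - b)).re)) +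
        ENNReal.ofReal (Real.exp (2 * s * (-1 * (⟪(ψ : H), B ψ⟫_ℂ - b)).re)) +
        ENNReal.ofReal (Real.exp (2 * s * (Complex.I * (⟪(ψ : H), B ψ⟫_ℂ - b)).re)) +
        ENNReal.ofReal (Real.exp (2 * s * (-Complex.I * (⟪(ψ : H), B ψ⟫_ℂ - b)).re)))
          ∂scroogeMeasure e p := by
        refine lintegral_mono fun ψ => ?_
        rw [← ENNReal.ofReal_add (by positivity) (by positivity),
          ← ENNReal.ofReal_add (by positivity) (by positivity),
          ← ENNReal.ofReal_add (by positivity) (by positivity),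
          ← ENNReal.ofReal_mul (by positivity), one_mul]
        exact ENNReal.ofReal_le_ofReal (exp_norm_le hs0 _)
    _ ≤ ENNReal.ofReal (1 / 2) * (K + K + K + K) := by
        rw [lintegral_const_mul' _ _ ENNReal.ofReal_ne_top, lintegral_add_right _ (hm _),
          lintegral_add_right _ (hm _), lintegral_add_right _ (hm _)]
        gcongr
        · exact key 1 (by simp)
        · exact key (-1) (by simp)
        · exact key Complex.I (by simp)
        · exact key (-Complex.I) (by simp)
    _ = _ := by
        rw [hK, ← ENNReal.ofReal_add (by positivity) (by positivity),
          ← ENNReal.ofReal_add (by positivity) (by positivity),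
          ← ENNReal.ofReal_add (by positivity) (by positivity),
          ← ENNReal.ofReal_mul (by positivity)]
        congr 1
        ring

end

/-! ### Matrix elements of partial traces -/

section

variable {Ha Hb : Type*} [NormedAddCommGroup Ha] [InnerProductSpace ℂ Ha]
  [NormedAddCommGroup Hb] [InnerProductSpace ℂ Hb]

theorem inner_partialInner (a : Ha) (l : Hb) (x : Ha ⊗[ℂ] Hb) :
    ⟪a, partialInner l x⟫_ℂ = ⟪a ⊗ₜ[ℂ] l, x⟫_ℂ := by
  induction x with
  | zero => simp
  | tmul c y => simp [partialInner, mul_comm]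
  | add x y hx hy => rw [map_add, inner_add_right, inner_add_right, hx, hy]

theorem inner_partialDiag [FiniteDimensional ℂ Ha]
    (T : (Ha ⊗[ℂ] Hb) →L[ℂ] (Ha ⊗[ℂ] Hb)) (l : Hb) (a c : Ha) :
    ⟪a, partialDiag T l c⟫_ℂ = ⟪a ⊗ₜ[ℂ] l, T (c ⊗ₜ[ℂ] l)⟫_ℂ :=
  inner_partialInner a l _

theorem ContinuousLinearMap.eq_sum_inner_smul_rankOne {κ : Type*} [Fintype κ]
    (e : OrthonormalBasis κ ℂ Ha) (M : Ha →L[ℂ] Ha) :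
    M = ∑ i, ∑ j, ⟪e i, M (e j)⟫_ℂ • InnerProductSpace.rankOne ℂ (e i) (e j) := by
  ext x
  simp only [_root_.sum_apply, _root_.smul_apply, InnerProductSpace.rankOne_apply]
  rw [Finset.sum_comm]
  conv_lhs => rw [← e.sum_repr' x, map_sum]
  refine Finset.sum_congr rfl fun j _ => ?_
  rw [map_smul]
  conv_lhs => rw [← e.sum_repr' (M (e j)), Finset.smul_sum]
  exact Finset.sum_congr rfl fun i _ => smul_comm _ _ _

/-- The basis inside `partialTrace` is an arbitrary choice, hence the hypothesis for every basis.
Expanding in the finitely many matrix units upgrades convergence of matrix elements to convergence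
of operators, without which the `tsum` would take its default value 0. -/
theorem inner_partialTrace [FiniteDimensional ℂ Ha] [CompleteSpace Hb]
    {T : (Ha ⊗[ℂ] Hb) →L[ℂ] (Ha ⊗[ℂ] Hb)} {t : Ha → Ha → ℂ}
    (ht : ∀ {w : Set Hb} (f : HilbertBasis w ℂ Hb) (a c : Ha),
      HasSum (fun i => ⟪a ⊗ₜ[ℂ] f i, T (c ⊗ₜ[ℂ] f i)⟫_ℂ) (t a c)) (a c : Ha) :
    ⟪a, partialTrace T c⟫_ℂ = t a c := by
  let f := (exists_hilbertBasis ℂ Hb).choose_spec.choose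
  let e := stdOrthonormalBasis ℂ Ha
  have h : Summable fun i => partialDiag T (f i) := by
    have h1 : ∀ i, partialDiag T (f i) = ∑ k, ∑ j,
        ⟪e k ⊗ₜ[ℂ] f i, T (e j ⊗ₜ[ℂ] f i)⟫_ℂ • InnerProductSpace.rankOne ℂ (e k) (e j) := by
      intro i
      rw [(partialDiag T (f i)).eq_sum_inner_smul_rankOne e]
      simp only [inner_partialDiag]
    simp only [h1]
    exact summable_sum fun k _ => summable_sum fun j _ => (ht f (e k) (e j)).summable.smul_const _
  have h2 : HasSum (fun i => partialDiag T (f i)) (partialTrace T) := h.hasSum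
  have h3 := h2.mapL ((innerSL ℂ a) ∘L (ContinuousLinearMap.apply ℂ Ha c))
  refine h3.unique ?_
  have h4 := ht f a c
  simp only [← inner_partialDiag] at h4
  exact h4

theorem norm_sum_tmul_sq {κ : Type*} [Fintype κ] (e : OrthonormalBasis κ ℂ Ha) (y : κ → Hb) :
    ‖∑ j, e j ⊗ₜ[ℂ] y j‖ ^ 2 = ∑ j, ‖y j‖ ^ 2 := by
  classical
  have h : ⟪∑ j, e j ⊗ₜ[ℂ] y j, ∑ j, e j ⊗ₜ[ℂ] y j⟫_ℂ = ((∑ j, ‖y j‖ ^ 2 : ℝ) : ℂ) := by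
    simp only [sum_inner, inner_sum, TensorProduct.inner_tmul, e.inner_eq_ite]
    simp [inner_self_eq_norm_sq_to_K]
  have h2 := (inner_self_eq_norm_sq_to_K (𝕜 := ℂ) (∑ j, e j ⊗ₜ[ℂ] y j)).symm.trans h
  exact Complex.ofReal_injective (by simpa using h2)

variable [CompleteSpace Hb] [FiniteDimensional ℂ Ha]

/-- The operator `|c⟩⟨a| ⊗ 1` on the tensor product. -/
noncomputable def rankOneTensor (a c : Ha) : (Ha ⊗[ℂ] Hb) →L[ℂ] (Ha ⊗[ℂ] Hb) :=
  TensorProduct.mkL ℂ Ha Hb c ∘L (TensorProduct.mkL ℂ Ha Hb a).adjoint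

theorem inner_rankOneTensor (a c : Ha) (x y : Ha ⊗[ℂ] Hb) :
    ⟪x, rankOneTensor a c y⟫_ℂ = ⟪(TensorProduct.mkL ℂ Ha Hb c).adjoint x,
      (TensorProduct.mkL ℂ Ha Hb a).adjoint y⟫_ℂ := by
  rw [rankOneTensor, ContinuousLinearMap.comp_apply, ContinuousLinearMap.adjoint_inner_left]

theorem inner_tmul_eq_inner_adjoint (a : Ha) (l : Hb) (x : Ha ⊗[ℂ] Hb) :
    ⟪a ⊗ₜ[ℂ] l, x⟫_ℂ = ⟪l, (TensorProduct.mkL ℂ Ha Hb a).adjoint x⟫_ℂ := by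
  rw [ContinuousLinearMap.adjoint_inner_right]
  rfl

theorem inner_adjoint_eq_inner_tmul (a : Ha) (l : Hb) (x : Ha ⊗[ℂ] Hb) :
    ⟪x, a ⊗ₜ[ℂ] l⟫_ℂ = ⟪(TensorProduct.mkL ℂ Ha Hb a).adjoint x, l⟫_ℂ := by
  rw [ContinuousLinearMap.adjoint_inner_left]
  rfl

theorem inner_reducedDensity (φ : Ha ⊗[ℂ] Hb) (a c : Ha) :
    ⟪a, reducedDensity φ c⟫_ℂ = ⟪φ, rankOneTensor a c φ⟫_ℂ := by
  rw [reducedDensity]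
  refine inner_partialTrace (t := fun a c => ⟪φ, rankOneTensor a c φ⟫_ℂ) (fun {w} f a c => ?_) a c
  rw [inner_rankOneTensor]
  have h : ∀ i, ⟪a ⊗ₜ[ℂ] f i, InnerProductSpace.rankOne ℂ φ φ (c ⊗ₜ[ℂ] f i)⟫_ℂ =
      ⟪(TensorProduct.mkL ℂ Ha Hb c).adjoint φ, f i⟫_ℂ *
        ⟪f i, (TensorProduct.mkL ℂ Ha Hb a).adjoint φ⟫_ℂ := by
    intro i
    rw [InnerProductSpace.rankOne_apply, inner_smul_right, inner_tmul_eq_inner_adjoint a,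
      inner_adjoint_eq_inner_tmul c]
  simp only [h]
  exact f.hasSum_inner_mul_inner _ _

/-- A unitary conjugate of a diagonal density operator has partial trace given by the
probability-weighted average of the reduced densities of the rotated eigenvectors. -/
theorem inner_partialTrace_conj {ι : Type*} (e : HilbertBasis ι ℂ (Ha ⊗[ℂ] Hb)) {p : ι → ℝ≥0}
    (hp : Summable fun i => (p i : ℝ)) {A : (Ha ⊗[ℂ] Hb) →L[ℂ] (Ha ⊗[ℂ] Hb)}
    (hA : ∀ i, A (e i) = (p i : ℂ) • e i) (V : (Ha ⊗[ℂ] Hb) →L[ℂ] (Ha ⊗[ℂ] Hb)) (a c : Ha) :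
    ⟪a, partialTrace (V * A * star V) c⟫_ℂ =
      ∑' i, (p i : ℂ) * ⟪V (e i), rankOneTensor a c (V (e i))⟫_ℂ := by
  refine inner_partialTrace (t := fun a c => ∑' i, (p i : ℂ) *
    ⟪V (e i), rankOneTensor a c (V (e i))⟫_ℂ) (fun {w} f a c => ?_) a c
  let Ka := (TensorProduct.mkL ℂ Ha Hb a).adjoint
  let Kc := (TensorProduct.mkL ℂ Ha Hb c).adjoint
  -- The claim is an interchange in a double sum: summing over the basis of the second factor first
  -- gives the expectations in the rotated eigenvectors (`hrow`), and summing over eigenvectors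
  -- first gives the diagonal terms of the partial trace (`hcol`).
  let F : ι × w → ℂ := fun x => (p x.1 : ℂ) *
    (⟪Kc (V (e x.1)), f x.2⟫_ℂ * ⟪f x.2, Ka (V (e x.1))⟫_ℂ)
  have hrow : ∀ i, HasSum (fun l => F (i, l))
      ((p i : ℂ) * ⟪V (e i), rankOneTensor a c (V (e i))⟫_ℂ) := by
    intro i
    rw [inner_rankOneTensor]
    exact (f.hasSum_inner_mul_inner _ _).mul_left _
  have hcol : ∀ l, HasSum (fun i => F (i, l))
      ⟪a ⊗ₜ[ℂ] f l, (V * A * star V) (c ⊗ₜ[ℂ] f l)⟫_ℂ := by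
    intro l
    have h1 := ((e.hasSum_repr (star V (c ⊗ₜ[ℂ] f l))).mapL (V ∘L A)).mapL
      (innerSL ℂ (a ⊗ₜ[ℂ] f l))
    have h2 : ∀ i, innerSL ℂ (a ⊗ₜ[ℂ] f l) ((V ∘L A)
        ((e.repr (star V (c ⊗ₜ[ℂ] f l))) i • e i)) = F (i, l) := by
      intro i
      have h3 : ∀ x, innerSL ℂ (a ⊗ₜ[ℂ] f l) x = ⟪f l, Ka x⟫_ℂ :=
        fun x => inner_tmul_eq_inner_adjoint a (f l) x
      have h4 : ⟪e i, star V (c ⊗ₜ[ℂ] f l)⟫_ℂ = ⟪Kc (V (e i)), f l⟫_ℂ := by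
        rw [← inner_adjoint_eq_inner_tmul c, ContinuousLinearMap.star_eq_adjoint,
          ContinuousLinearMap.adjoint_inner_right]
      rw [e.repr_apply_apply, h4, map_smul, ContinuousLinearMap.comp_apply, hA, h3]
      simp only [map_smul, inner_smul_right, F]
      ring
    simp only [h2] at h1
    exact h1
  have hpars : ∀ y : Hb, HasSum (fun l => ‖⟪f l, y⟫_ℂ‖ ^ 2) (‖y‖ ^ 2) := by
    intro y
    have h1 := Complex.hasSum_re (f.hasSum_inner_mul_inner y y)
    rw [inner_self_eq_norm_sq_to_K] at h1
    have h2 : ∀ l, (⟪y, f l⟫_ℂ * ⟪f l, y⟫_ℂ).re = ‖⟪f l, y⟫_ℂ‖ ^ 2 := by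
      intro l
      rw [← inner_conj_symm, Complex.conj_mul', ← Complex.ofReal_pow, Complex.ofReal_re]
    simp only [h2] at h1
    exact_mod_cast h1
  have hsum : Summable F := by
    -- A summable majorant from 2|xy| ≤ |x|² + |y|²: Parseval evaluates the inner sums, and the
    -- weights p i are summable.
    let G : ι × w → ℝ := fun x => p x.1 *
      (‖⟪f x.2, Kc (V (e x.1))⟫_ℂ‖ ^ 2 + ‖⟪f x.2, Ka (V (e x.1))⟫_ℂ‖ ^ 2)
    have hG0 : 0 ≤ G := fun x => by positivity
    have hGrow : ∀ i, HasSum (fun l => G (i, l))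
        (p i * (‖Kc (V (e i))‖ ^ 2 + ‖Ka (V (e i))‖ ^ 2)) := fun i =>
      ((hpars _).add (hpars _)).mul_left _
    have hle : ∀ (K : (Ha ⊗[ℂ] Hb) →L[ℂ] Hb) (i), ‖K (V (e i))‖ ≤ ‖K‖ * ‖V‖ := by
      intro K i
      refine (K.le_opNorm _).trans ?_
      gcongr
      simpa [e.orthonormal.1] using V.le_opNorm (e i)
    have hG : Summable G := by
      rw [summable_prod_of_nonneg hG0]
      refine ⟨fun i => (hGrow i).summable, ?_⟩
      simp only [(hGrow _).tsum_eq]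
      refine Summable.of_nonneg_of_le (fun i => by positivity) (fun i => ?_)
        (hp.mul_right ((‖Kc‖ * ‖V‖) ^ 2 + (‖Ka‖ * ‖V‖) ^ 2))
      gcongr
      · exact hle Kc i
      · exact hle Ka i
    refine Summable.of_norm_bounded hG fun x => ?_
    have h1 := two_mul_le_add_sq ‖⟪f x.2, Kc (V (e x.1))⟫_ℂ‖ ‖⟪f x.2, Ka (V (e x.1))⟫_ℂ‖
    have h2 : ‖⟪Kc (V (e x.1)), f x.2⟫_ℂ‖ = ‖⟪f x.2, Kc (V (e x.1))⟫_ℂ‖ := norm_inner_symm _ _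
    have h3 : ‖(p x.1 : ℂ)‖ = p x.1 := by simp
    simp only [F, G]
    rw [norm_mul, norm_mul, h2, h3]
    have h4 : 0 ≤ ‖⟪f x.2, Kc (V (e x.1))⟫_ℂ‖ * ‖⟪f x.2, Ka (V (e x.1))⟫_ℂ‖ := by positivity
    gcongr
    linarith
  have h1 : HasSum (fun i => (p i : ℂ) * ⟪V (e i), rankOneTensor a c (V (e i))⟫_ℂ) (∑' x, F x) :=
    hsum.hasSum.prod_fiberwise hrow
  rw [h1.tsum_eq]
  have h2 : HasSum (F ∘ (Equiv.prodComm w ι)) (∑' x, F x) :=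
    (Equiv.hasSum_iff _).2 hsum.hasSum
  exact h2.prod_fiberwise hcol

/-! ### Signed shifts as contractions -/

/-- The vector v reassembled from the components of x satisfies ⟨x, v⟩ = ‖v‖², so Cauchy–Schwarz
gives ‖v‖ ≤ ‖x‖. The identity v = x is not needed. -/
theorem sum_norm_adjoint_mkL_sq_le {κ : Type*} [Fintype κ] (e : OrthonormalBasis κ ℂ Ha)
    (x : Ha ⊗[ℂ] Hb) : ∑ j, ‖(TensorProduct.mkL ℂ Ha Hb (e j)).adjoint x‖ ^ 2 ≤ ‖x‖ ^ 2 := by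
  set y : κ → Hb := fun j => (TensorProduct.mkL ℂ Ha Hb (e j)).adjoint x with hy
  set v := ∑ j, e j ⊗ₜ[ℂ] y j with hv
  have h1 : ‖v‖ ^ 2 = ∑ j, ‖y j‖ ^ 2 := norm_sum_tmul_sq e y
  have h2 : ⟪x, v⟫_ℂ = ((‖v‖ ^ 2 : ℝ) : ℂ) := by
    rw [h1, hv, inner_sum]
    simp only [inner_adjoint_eq_inner_tmul]
    push_cast
    refine Finset.sum_congr rfl fun j _ => ?_
    exact inner_self_eq_norm_sq_to_K _
  have h3 : ‖v‖ ^ 2 ≤ ‖x‖ * ‖v‖ := by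
    have h4 := norm_inner_le_norm (𝕜 := ℂ) x v
    rw [h2, Complex.norm_real, Real.norm_of_nonneg (by positivity)] at h4
    exact h4
  change ∑ j, ‖y j‖ ^ 2 ≤ _
  rw [← h1]
  have h5 : ‖v‖ ≤ ‖x‖ := by
    rcases (norm_nonneg v).eq_or_lt with h | h
    · rw [← h]; positivity
    · nlinarith
  gcongr

/-- The operator `∑ σ j |e j⟩⟨e (π j)| ⊗ 1`. -/
noncomputable def signedShift {κ : Type*} [Fintype κ] (e : OrthonormalBasis κ ℂ Ha)
    (π : Equiv.Perm κ) (σ : κ → ℤˣ) : (Ha ⊗[ℂ] Hb) →L[ℂ] (Ha ⊗[ℂ] Hb) :=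
  ∑ j, ((σ j : ℤ) : ℂ) • rankOneTensor (e (π j)) (e j)

/-- The operator permutes the components of x along the basis and multiplies them by signs; neither
changes the sum of their squared norms. -/
theorem norm_signedShift_le {κ : Type*} [Fintype κ] (e : OrthonormalBasis κ ℂ Ha)
    (π : Equiv.Perm κ) (σ : κ → ℤˣ) : ‖signedShift (Hb := Hb) e π σ‖ ≤ 1 := by
  refine ContinuousLinearMap.opNorm_le_bound _ zero_le_one fun x => ?_
  rw [one_mul]
  refine (sq_le_sq₀ (norm_nonneg _) (norm_nonneg _)).1 ?_
  have h1 : signedShift e π σ x = ∑ j, e j ⊗ₜ[ℂ]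
      (((σ j : ℤ) : ℂ) • (TensorProduct.mkL ℂ Ha Hb (e (π j))).adjoint x) := by
    simp only [signedShift, _root_.sum_apply, _root_.smul_apply, TensorProduct.tmul_smul]
    rfl
  have h2 : ∀ j, ‖((σ j : ℤ) : ℂ)‖ = 1 := by
    intro j
    rcases Int.units_eq_one_or (σ j) with h | h <;> simp [h]
  rw [h1, norm_sum_tmul_sq]
  simp only [norm_smul, h2, one_mul]
  rw [Equiv.sum_comp π fun j => ‖(TensorProduct.mkL ℂ Ha Hb (e j)).adjoint x‖ ^ 2]
  exact sum_norm_adjoint_mkL_sq_le e x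

end

/-! ### Random signs, the trace norm and a convexity inequality -/

/-- Independent signs are orthonormal: flipping the sign at j is a bijection that negates σ j σ k
for k ≠ j, so the cross terms cancel in the sum. -/
theorem sum_norm_sq_sum_signs {κ : Type*} [Fintype κ] [DecidableEq κ] (a : κ → ℂ) :
    ∑ σ : κ → ℤˣ, ‖∑ j, ((σ j : ℤ) : ℂ) * a j‖ ^ 2 = 2 ^ Fintype.card κ * ∑ j, ‖a j‖ ^ 2 := by
  have h0 : ∀ j k, j ≠ k → ∑ σ : κ → ℤˣ, ((σ j : ℤ) : ℂ) * ((σ k : ℤ) : ℂ) = 0 := by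
    intro j k hjk
    have h := Equiv.sum_comp (Equiv.mulLeft (Pi.mulSingle j (-1) : κ → ℤˣ))
      (fun σ : κ → ℤˣ => ((σ j : ℤ) : ℂ) * ((σ k : ℤ) : ℂ))
    simp only [Equiv.coe_mulLeft, Pi.mul_apply, Pi.mulSingle_eq_same,
      Pi.mulSingle_eq_of_ne hjk.symm, one_mul, neg_mul, Units.val_neg, Int.cast_neg,
      Finset.sum_neg_distrib] at h
    exact self_eq_neg.1 h.symm
  have h1 : ∀ j, ∑ σ : κ → ℤˣ, ((σ j : ℤ) : ℂ) * ((σ j : ℤ) : ℂ) = 2 ^ Fintype.card κ := by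
    intro j
    have h : ∀ σ : κ → ℤˣ, ((σ j : ℤ) : ℂ) * ((σ j : ℤ) : ℂ) = 1 := by
      intro σ
      rcases Int.units_eq_one_or (σ j) with h | h <;> simp [h]
    simp [h]
  have h2 : ∀ σ : κ → ℤˣ, ((‖∑ j, ((σ j : ℤ) : ℂ) * a j‖ ^ 2 : ℝ) : ℂ) =
      ∑ j, ∑ k, (((σ j : ℤ) : ℂ) * ((σ k : ℤ) : ℂ)) * ((starRingEnd ℂ) (a j) * a k) := by
    intro σ
    push_cast
    rw [← Complex.conj_mul', map_sum, Finset.sum_mul_sum]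
    refine Finset.sum_congr rfl fun j _ => Finset.sum_congr rfl fun k _ => ?_
    rw [map_mul, map_intCast]
    ring
  apply Complex.ofReal_injective
  rw [Complex.ofReal_sum]
  simp only [h2]
  rw [Finset.sum_comm]
  push_cast
  rw [Finset.mul_sum]
  refine Finset.sum_congr rfl fun j _ => ?_
  rw [Finset.sum_comm, Finset.sum_eq_single j]
  · rw [← Finset.sum_mul, h1, Complex.conj_mul']
  · intro k _ hk
    rw [← Finset.sum_mul, h0 j k hk.symm, zero_mul]
  · simp

section

variable {Ha : Type*} [NormedAddCommGroup Ha] [InnerProductSpace ℂ Ha] [FiniteDimensional ℂ Ha]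

/-- With A = |M| one has ‖Ax‖ = ‖Mx‖, so tr A = ∑ ⟨e j, A e j⟩ ≤ ∑ ‖M e j‖, and Cauchy–Schwarz
compares this with the Hilbert–Schmidt norm. -/
theorem traceNorm_le {κ : Type*} [Fintype κ] (e : OrthonormalBasis κ ℂ Ha) (M : Ha →L[ℂ] Ha) :
    traceNorm M ≤ √(Fintype.card κ * ∑ j, ∑ i, ‖⟪e i, M (e j)⟫_ℂ‖ ^ 2) := by
  have : CompleteSpace Ha := FiniteDimensional.complete ℂ Ha
  set A : Ha →L[ℂ] Ha := CFC.sqrt (star M * M) with hA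
  have hAA : A * A = star M * M := CFC.sqrt_mul_sqrt_self _ (star_mul_self_nonneg M)
  have hAp : A.IsPositive :=
    (ContinuousLinearMap.nonneg_iff_isPositive _).1 (CFC.sqrt_nonneg (star M * M))
  have hn : ∀ x, ‖A x‖ = ‖M x‖ := by
    intro x
    have h1 : ⟪A x, A x⟫_ℂ = ⟪M x, M x⟫_ℂ := by
      rw [hAp.inner_left_eq_inner_right, ← ContinuousLinearMap.adjoint_inner_right,
        ← ContinuousLinearMap.star_eq_adjoint]
      exact congrArg (fun B : Ha →L[ℂ] Ha => ⟪x, B x⟫_ℂ) hAA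
    rw [inner_self_eq_norm_sq_to_K, inner_self_eq_norm_sq_to_K] at h1
    have h2 : ‖A x‖ ^ 2 = ‖M x‖ ^ 2 := by exact_mod_cast Complex.ofReal_injective (by simpa using h1)
    exact (sq_eq_sq₀ (norm_nonneg _) (norm_nonneg _)).1 h2
  have h3 : ∀ j, ∑ i, ‖⟪e i, M (e j)⟫_ℂ‖ ^ 2 = ‖A (e j)‖ ^ 2 := by
    intro j
    rw [hn, e.sum_sq_norm_inner_right]
  change (LinearMap.trace ℂ Ha (A : Ha →ₗ[ℂ] Ha)).re ≤ _
  simp only [h3]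
  refine Real.le_sqrt_of_sq_le ?_
  rw [LinearMap.trace_eq_sum_inner _ e, Complex.re_sum]
  refine sq_sum_le_card_mul_sum_sq.trans ?_
  rw [Finset.card_univ]
  refine mul_le_mul_of_nonneg_left (Finset.sum_le_sum fun j _ => ?_) (by positivity)
  have h4 := (Complex.abs_re_le_norm _).trans (norm_inner_le_norm (𝕜 := ℂ) (e j) (A (e j)))
  rw [e.orthonormal.1, one_mul] at h4
  exact sq_le_sq' (abs_le.1 h4).1 (abs_le.1 h4).2

/-- Serves the measurability of the deviation; it rests on continuity of the square root on positive
operators. -/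
theorem continuous_traceNorm : Continuous (traceNorm : (Ha →L[ℂ] Ha) → ℝ) := by
  have : CompleteSpace Ha := FiniteDimensional.complete ℂ Ha
  have h1 : Continuous fun M : Ha →L[ℂ] Ha => CFC.sqrt (star M * M) := by
    simp only [CFC.sqrt_eq_cfc]
    exact Continuous.cfc_nnreal_of_mem_nhdsSet NNReal.sqrt (s := Set.univ) Filter.univ_mem
      (by fun_prop) (fun M => star_mul_self_nonneg M) NNReal.continuous_sqrt.continuousOn
  have h2 : Continuous fun A : Ha →L[ℂ] Ha => (LinearMap.trace ℂ Ha (A : Ha →ₗ[ℂ] Ha)).re := by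
    let e := stdOrthonormalBasis ℂ Ha
    simp only [LinearMap.trace_eq_sum_inner _ e, ContinuousLinearMap.coe_coe]
    fun_prop
  exact h2.comp h1

end

/-- Bernoulli's inequality in exponential form. -/
theorem one_add_mul_sq_sub_one_le_exp {τ w : ℝ} (hτ : 1 ≤ τ) (hw : 0 ≤ w) :
    1 + τ * (w ^ 2 - 1) ≤ Real.exp (2 * τ * (w - 1)) := by
  have h1 := one_add_mul_self_le_rpow_one_add (s := w ^ 2 - 1) (by nlinarith) hτ
  refine h1.trans ?_
  have h2 : w ≤ Real.exp (w - 1) := by simpa using Real.add_one_le_exp (w - 1)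
  calc (1 + (w ^ 2 - 1)) ^ τ = (w ^ 2) ^ τ := by congr 1; ring
    _ ≤ (Real.exp (w - 1) ^ 2) ^ τ := by gcongr
    _ = Real.exp (2 * τ * (w - 1)) := by
      rw [← Real.exp_nat_mul, ← Real.exp_mul]
      congr 1
      push_cast
      ring

/-- With w the root mean square of the x k / δ, y ≤ w gives 2(y − 1) ≤ w² − 1. The right side is the
mean of (x k / δ)² − 1, to which Bernoulli's inequality applies term by term. The left side is
affine in y, so it can be averaged over time, and it is at least 1 once the average of y is. -/
theorem one_add_mul_sub_one_le_average_exp {K : Type*} [Fintype K] [Nonempty K] {τ y δ : ℝ}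
    (hτ : 1 ≤ τ) (hδ : 0 < δ) {x : K → ℝ} (hx : ∀ k, 0 ≤ x k)
    (hy : y * δ ≤ √((∑ k, x k ^ 2) / Fintype.card K)) :
    1 + 2 * τ * (y - 1) ≤ (∑ k, Real.exp (2 * τ * (x k / δ - 1))) / Fintype.card K := by
  have hK : (0 : ℝ) < Fintype.card K := by exact_mod_cast Fintype.card_pos
  set w := √((∑ k, x k ^ 2) / Fintype.card K) / δ with hw
  have hyw : y ≤ w := by rwa [hw, le_div_iff₀ hδ]
  have hw2 : w ^ 2 * Fintype.card K = ∑ k, (x k / δ) ^ 2 := by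
    rw [hw, div_pow, Real.sq_sqrt (div_nonneg (Finset.sum_nonneg fun _ _ => sq_nonneg _) hK.le)]
    simp only [div_pow, ← Finset.sum_div]
    field_simp
  have h1 : ∑ k, (1 + τ * ((x k / δ) ^ 2 - 1)) ≤ ∑ k, Real.exp (2 * τ * (x k / δ - 1)) :=
    Finset.sum_le_sum fun k _ => one_add_mul_sq_sub_one_le_exp hτ (div_nonneg (hx k) hδ.le)
  have h2 : ∑ k, (1 + τ * ((x k / δ) ^ 2 - 1)) =
      Fintype.card K * (1 + τ * (w ^ 2 - 1)) := by
    rw [Finset.sum_add_distrib, ← Finset.mul_sum, Finset.sum_sub_distrib, ← hw2]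
    simp
    ring
  rw [le_div_iff₀ hK]
  refine le_trans ?_ h1
  rw [h2, mul_comm]
  refine mul_le_mul_of_nonneg_left ?_ hK.le
  have h3 : 2 * (y - 1) ≤ w ^ 2 - 1 := by nlinarith [sq_nonneg (w - 1)]
  have h4 := mul_le_mul_of_nonneg_left h3 (zero_le_one.trans hτ)
  linarith

/-! ### Deviations of expectation values -/

section

variable {H : Type*} [NormedAddCommGroup H] [InnerProductSpace ℂ H]

/-- The deviation of the expectation of `C` in the state `ψ` from its expectation in the density
operator with eigenbasis `e` and eigenvalues `p`. -/
noncomputable def expectationDeviation {ι : Type*} (e : HilbertBasis ι ℂ H) (p : ι → ℝ≥0)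
    (C : H →L[ℂ] H) (ψ : H) : ℂ :=
  ⟪ψ, C ψ⟫_ℂ - ∑' i, (p i : ℂ) * ⟪e i, C (e i)⟫_ℂ

theorem norm_inner_self_apply_le (C : H →L[ℂ] H) {x : H} (hx : ‖x‖ = 1) :
    ‖⟪x, C x⟫_ℂ‖ ≤ ‖C‖ := by
  have h1 := (norm_inner_le_norm (𝕜 := ℂ) x (C x)).trans
    (mul_le_mul_of_nonneg_left (C.le_opNorm _) (norm_nonneg _))
  rwa [hx, one_mul, mul_one] at h1

theorem hasSum_inner_eigenbasis {ι : Type*} (e : HilbertBasis ι ℂ H) {p : ι → ℝ≥0}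
    (hp : Summable fun i => (p i : ℝ)) (C : H →L[ℂ] H) :
    HasSum (fun i => (p i : ℂ) * ⟪e i, C (e i)⟫_ℂ) (∑' i, (p i : ℂ) * ⟪e i, C (e i)⟫_ℂ) := by
  refine Summable.hasSum (Summable.of_norm_bounded (hp.mul_right ‖C‖) fun i => ?_)
  rw [norm_mul]
  have h1 : ‖(p i : ℂ)‖ = p i := by simp
  rw [h1]
  gcongr
  exact norm_inner_self_apply_le C (e.orthonormal.1 i)

theorem norm_expectationDeviation_le {ι : Type*} (e : HilbertBasis ι ℂ H) {p : ι → ℝ≥0}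
    (hp : HasSum (fun i => (p i : ℝ)) 1) (C : H →L[ℂ] H) {ψ : H} (hψ : ‖ψ‖ = 1) :
    ‖expectationDeviation e p C ψ‖ ≤ 2 * ‖C‖ := by
  have h1 : ‖∑' i, (p i : ℂ) * ⟪e i, C (e i)⟫_ℂ‖ ≤ 1 * ‖C‖ := by
    refine tsum_of_norm_bounded (hp.mul_right ‖C‖) fun i => ?_
    have h1 : ‖(p i : ℂ)‖ = p i := by simp
    rw [norm_mul, h1]
    gcongr
    exact norm_inner_self_apply_le C (e.orthonormal.1 i)
  refine (norm_sub_le _ _).trans ?_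
  have := norm_inner_self_apply_le C hψ
  linarith

theorem expectationDeviation_sum {ι κ : Type*} [Fintype κ] (e : HilbertBasis ι ℂ H) {p : ι → ℝ≥0}
    (hp : Summable fun i => (p i : ℝ)) (c : κ → ℂ) (C : κ → H →L[ℂ] H) (ψ : H) :
    expectationDeviation e p (∑ j, c j • C j) ψ =
      ∑ j, c j * expectationDeviation e p (C j) ψ := by
  have h1 : ∀ x, ⟪x, (∑ j, c j • C j) x⟫_ℂ = ∑ j, c j * ⟪x, C j x⟫_ℂ := by
    intro x
    simp only [_root_.sum_apply, _root_.smul_apply, inner_sum, inner_smul_right]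
  have h2 : HasSum (fun i => (p i : ℂ) * ∑ j, c j * ⟪e i, C j (e i)⟫_ℂ)
      (∑ j, c j * ∑' i, (p i : ℂ) * ⟪e i, C j (e i)⟫_ℂ) := by
    have h3 := hasSum_sum (s := Finset.univ) fun j (_ : j ∈ Finset.univ) =>
      (hasSum_inner_eigenbasis e hp (C j)).mul_left (c j)
    simp only [mul_left_comm (c _), ← Finset.mul_sum] at h3
    exact h3
  simp only [expectationDeviation, h1]
  rw [h2.tsum_eq, ← Finset.sum_sub_distrib]
  simp only [mul_sub]

end

/-! ### The trace norm as an average over signed shifts -/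

section

variable {Ha : Type*} [NormedAddCommGroup Ha] [InnerProductSpace ℂ Ha] [FiniteDimensional ℂ Ha]

theorem traceNorm_nonneg (M : Ha →L[ℂ] Ha) : 0 ≤ traceNorm M := by
  have : CompleteSpace Ha := FiniteDimensional.complete ℂ Ha
  have hAp : (CFC.sqrt (star M * M) : Ha →L[ℂ] Ha).IsPositive :=
    (ContinuousLinearMap.nonneg_iff_isPositive _).1 (CFC.sqrt_nonneg (star M * M))
  change 0 ≤ (LinearMap.trace ℂ Ha ((CFC.sqrt (star M * M) : Ha →L[ℂ] Ha) : Ha →ₗ[ℂ] Ha)).re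
  rw [LinearMap.trace_eq_sum_inner _ (stdOrthonormalBasis ℂ Ha), Complex.re_sum]
  exact Finset.sum_nonneg fun i _ => hAp.re_inner_nonneg_right _

/-- The group structure makes (j, l) ↦ (j + l, j) run through every matrix position once. Averaging
over signs removes the cross terms, so the mean square on the right is the squared Hilbert–Schmidt
norm divided by the dimension. -/
theorem traceNorm_le_card_mul_sqrt_average {κ : Type*} [Fintype κ] [DecidableEq κ]
    [AddCommGroup κ] (e : OrthonormalBasis κ ℂ Ha) (M : Ha →L[ℂ] Ha) :
    traceNorm M ≤ Fintype.card κ * √((∑ k : κ × (κ → ℤˣ),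
      ‖∑ j, ((k.2 j : ℤ) : ℂ) * ⟪e (j + k.1), M (e j)⟫_ℂ‖ ^ 2) /
        Fintype.card (κ × (κ → ℤˣ))) := by
  have hκ : (0 : ℝ) < Fintype.card κ := by
    exact_mod_cast Fintype.card_pos
  refine (traceNorm_le e M).trans_eq ?_
  rw [Fintype.sum_prod_type]
  simp only [sum_norm_sq_sum_signs]
  have h1 : ∑ l, ∑ j, ‖⟪e (j + l), M (e j)⟫_ℂ‖ ^ 2 = ∑ j, ∑ i, ‖⟪e i, M (e j)⟫_ℂ‖ ^ 2 := by
    rw [Finset.sum_comm]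
    exact Finset.sum_congr rfl fun j _ =>
      Equiv.sum_comp (Equiv.addLeft j) fun i => ‖⟪e i, M (e j)⟫_ℂ‖ ^ 2
  rw [← Finset.mul_sum, h1]
  have h2 : (Fintype.card (κ × (κ → ℤˣ)) : ℝ) = Fintype.card κ * 2 ^ Fintype.card κ := by
    simp
  rw [h2, ← Real.sqrt_sq hκ.le, ← Real.sqrt_mul (sq_nonneg _), Real.sqrt_sq hκ.le]
  congr 1
  field_simp

variable {Hb : Type*} [NormedAddCommGroup Hb] [InnerProductSpace ℂ Hb]

instance TensorProduct.separableSpace_of_finiteDimensional [TopologicalSpace.SeparableSpace Hb] :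
    TopologicalSpace.SeparableSpace (Ha ⊗[ℂ] Hb) := by
  let e := stdOrthonormalBasis ℂ Ha
  let f : (Fin (Module.finrank ℂ Ha) → Hb) → Ha ⊗[ℂ] Hb := fun y => ∑ i, e i ⊗ₜ[ℂ] y i
  have hf : Continuous f :=
    continuous_finsetSum _ fun i _ => (TensorProduct.mkL ℂ Ha Hb (e i)).continuous.comp
      (continuous_apply i)
  have hs : Function.Surjective f := by
    intro x
    induction x with
    | zero => exact ⟨0, by simp [f]⟩
    | tmul a y =>
      refine ⟨fun i => ⟪e i, a⟫_ℂ • y, ?_⟩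
      simp only [f, ← TensorProduct.smul_tmul, ← TensorProduct.sum_tmul]
      rw [e.sum_repr' a]
    | add x y hx hy =>
      obtain ⟨u, rfl⟩ := hx
      obtain ⟨v, rfl⟩ := hy
      exact ⟨u + v, by simp [f, TensorProduct.tmul_add, Finset.sum_add_distrib]⟩
  exact hs.denseRange.separableSpace hf

end

/-! ### Heisenberg evolution and the reduced deviation -/

section

variable {H : Type*} [NormedAddCommGroup H] [InnerProductSpace ℂ H] [CompleteSpace H]
  (U : ℝ → unitary (H →L[ℂ] H))

/-- The Heisenberg evolution `U_t^* C U_t` of an operator. -/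
noncomputable def heisenberg (C : H →L[ℂ] H) (t : ℝ) :
    H →L[ℂ] H :=
  star (U t : H →L[ℂ] H) * C * (U t : H →L[ℂ] H)

theorem inner_heisenberg (C : H →L[ℂ] H) (t : ℝ) (x : H) :
    ⟪x, heisenberg U C t x⟫_ℂ = ⟪(U t : H →L[ℂ] H) x,
      C ((U t : H →L[ℂ] H) x)⟫_ℂ := by
  rw [← ContinuousLinearMap.adjoint_inner_right]
  rfl

theorem norm_heisenberg (C : H →L[ℂ] H) (t : ℝ) :
    ‖heisenberg U C t‖ = ‖C‖ := by
  rw [heisenberg, CStarRing.norm_mul_coe_unitary, ← Unitary.coe_star,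
    CStarRing.norm_coe_unitary_mul]

theorem heisenberg_sum_smul {κ : Type*} [Fintype κ] (c : κ → ℂ)
    (C : κ → H →L[ℂ] H) (t : ℝ) :
    heisenberg U (∑ j, c j • C j) t = ∑ j, c j • heisenberg U (C j) t := by
  ext x
  simp only [heisenberg, mul_apply_eq_comp, _root_.sum_apply, _root_.smul_apply, map_sum, map_smul]

end

section

variable {Ha Hb : Type*} [NormedAddCommGroup Ha] [InnerProductSpace ℂ Ha] [FiniteDimensional ℂ Ha]
  [NormedAddCommGroup Hb] [InnerProductSpace ℂ Hb] [CompleteSpace Hb]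

theorem DensityOperator.eigenvalue_le_norm {H : Type*} [NormedAddCommGroup H]
    [InnerProductSpace ℂ H] (ρ : DensityOperator H) {ι : Type*} (e : HilbertBasis ι ℂ H)
    {p : ι → ℝ≥0} (he : ∀ i, ρ.op (e i) = (p i : ℂ) • e i) (i : ι) : (p i : ℝ) ≤ ‖ρ.op‖ := by
  have h := ρ.op.le_opNorm (e i)
  rw [he, norm_smul, e.orthonormal.1] at h
  simpa using h

theorem DensityOperator.tsum_eigenvalues {H : Type*} [NormedAddCommGroup H]
    [InnerProductSpace ℂ H] [CompleteSpace H] (ρ : DensityOperator H) {ι : Type*}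
    (e : HilbertBasis ι ℂ H) {p : ι → ℝ≥0} (he : ∀ i, ρ.op (e i) = (p i : ℂ) • e i) :
    ∑' i, (p i : ℝ≥0∞) = 1 := by
  rw [← ρ.tsum_ofReal_inner_eq_one e]
  refine tsum_congr fun i => ?_
  rw [he i, inner_smul_right, inner_self_eq_norm_sq_to_K, e.orthonormal.1]
  simp

variable {ι : Type*} (e : HilbertBasis ι ℂ (Ha ⊗[ℂ] Hb)) {p : ι → ℝ≥0}
  (ρ : DensityOperator (Ha ⊗[ℂ] Hb)) (U : ℝ → unitary ((Ha ⊗[ℂ] Hb) →L[ℂ] (Ha ⊗[ℂ] Hb)))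

/-- The operator `ρ_a^{ψ_t} - tr_b ρ_t`. -/
noncomputable def reducedDifference (ψ : Ha ⊗[ℂ] Hb) (t : ℝ) : Ha →L[ℂ] Ha :=
  reducedDensity ((U t : (Ha ⊗[ℂ] Hb) →L[ℂ] (Ha ⊗[ℂ] Hb)) ψ) -
    partialTrace ((U t : (Ha ⊗[ℂ] Hb) →L[ℂ] (Ha ⊗[ℂ] Hb)) * ρ.op *
      star (U t : (Ha ⊗[ℂ] Hb) →L[ℂ] (Ha ⊗[ℂ] Hb)))

theorem inner_reducedDifference (he : ∀ i, ρ.op (e i) = (p i : ℂ) • e i)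
    (hp : HasSum (fun i => (p i : ℝ)) 1) (ψ : Ha ⊗[ℂ] Hb) (t : ℝ) (a c : Ha) :
    ⟪a, reducedDifference ρ U ψ t c⟫_ℂ =
      expectationDeviation e p (heisenberg U (rankOneTensor a c) t) ψ := by
  rw [reducedDifference, _root_.sub_apply, inner_sub_right, inner_reducedDensity,
    inner_partialTrace_conj e hp.summable he, expectationDeviation]
  simp only [inner_heisenberg]

/-- By linearity, the signed sums of matrix elements are deviations of single operators: the
time-evolved signed shifts, all contractions. -/
theorem reducedDeviation_le {κ : Type*} [Fintype κ] [DecidableEq κ] [AddCommGroup κ]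
    (b : OrthonormalBasis κ ℂ Ha) (he : ∀ i, ρ.op (e i) = (p i : ℂ) • e i)
    (hp : HasSum (fun i => (p i : ℝ)) 1) (ψ : Ha ⊗[ℂ] Hb) (t : ℝ) :
    reducedDeviation ρ U ψ t ≤ Fintype.card κ * √((∑ k : κ × (κ → ℤˣ),
      ‖expectationDeviation e p (heisenberg U (signedShift b (Equiv.addRight k.1) k.2) t) ψ‖ ^ 2) /
        Fintype.card (κ × (κ → ℤˣ))) := by
  refine (traceNorm_le_card_mul_sqrt_average b (reducedDifference ρ U ψ t)).trans_eq ?_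
  simp only [inner_reducedDifference e ρ U he hp, signedShift, heisenberg_sum_smul,
    expectationDeviation_sum e hp.summable, Equiv.coe_addRight]

theorem reducedDeviation_nonneg (ψ : Ha ⊗[ℂ] Hb) (t : ℝ) : 0 ≤ reducedDeviation ρ U ψ t :=
  traceNorm_nonneg _

theorem norm_expectationDeviation_signedShift_le {κ : Type*} [Fintype κ]
    (b : OrthonormalBasis κ ℂ Ha) (hp : HasSum (fun i => (p i : ℝ)) 1) {ψ : Ha ⊗[ℂ] Hb}
    (hψ : ‖ψ‖ = 1) (t : ℝ) (π : Equiv.Perm κ) (σ : κ → ℤˣ) :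
    ‖expectationDeviation e p (heisenberg U (signedShift b π σ) t) ψ‖ ≤ 2 := by
  have h1 := norm_expectationDeviation_le e hp (heisenberg U (signedShift b π σ) t) hψ
  have h2 := (norm_heisenberg U (signedShift b π σ) t).trans_le (norm_signedShift_le b π σ)
  linarith

theorem reducedDeviation_le_two_mul_card {κ : Type*} [Fintype κ] [DecidableEq κ] [AddCommGroup κ]
    (b : OrthonormalBasis κ ℂ Ha) (he : ∀ i, ρ.op (e i) = (p i : ℂ) • e i)
    (hp : HasSum (fun i => (p i : ℝ)) 1) {ψ : Ha ⊗[ℂ] Hb} (hψ : ‖ψ‖ = 1) (t : ℝ) :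
    reducedDeviation ρ U ψ t ≤ 2 * Fintype.card κ := by
  refine (reducedDeviation_le e ρ U b he hp ψ t).trans ?_
  rw [mul_comm]
  gcongr
  refine Real.sqrt_le_iff.2 ⟨by norm_num, ?_⟩
  refine div_le_of_le_mul₀ (by positivity) (by norm_num) ?_
  refine (Finset.sum_le_card_nsmul _ _ (2 ^ 2) fun k _ => ?_).trans_eq ?_
  · gcongr
    exact norm_expectationDeviation_signedShift_le e U b hp hψ t _ _
  · rw [nsmul_eq_mul, Finset.card_univ, mul_comm]

variable [TopologicalSpace.SeparableSpace Hb] [MeasurableSpace (Ha ⊗[ℂ] Hb)]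
  [BorelSpace (Ha ⊗[ℂ] Hb)]

/-- U_t φ is continuous in φ and measurable in t, a Carathéodory function, hence jointly measurable
because the space is separable. -/
theorem measurable_expectationDeviation_heisenberg
    (hU : ∀ φ : Ha ⊗[ℂ] Hb, Measurable fun t => (U t : (Ha ⊗[ℂ] Hb) →L[ℂ] (Ha ⊗[ℂ] Hb)) φ)
    (C : (Ha ⊗[ℂ] Hb) →L[ℂ] (Ha ⊗[ℂ] Hb)) :
    Measurable fun x : Metric.sphere (0 : Ha ⊗[ℂ] Hb) 1 × ℝ =>
      expectationDeviation e p (heisenberg U C x.2) x.1 := by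
  have := UniformSpace.secondCountable_of_separable (Ha ⊗[ℂ] Hb)
  have := e.countable
  have hC : Measurable fun x : Ha ⊗[ℂ] Hb => ⟪x, C x⟫_ℂ :=
    (Continuous.inner (𝕜 := ℂ) continuous_id C.continuous).measurable
  have h1 : Measurable (Function.uncurry fun (φ : Ha ⊗[ℂ] Hb) (t : ℝ) =>
      (U t : (Ha ⊗[ℂ] Hb) →L[ℂ] (Ha ⊗[ℂ] Hb)) φ) :=
    measurable_uncurry_of_continuous_of_measurable (fun t => (U t).1.continuous) hU
  have h2 : Measurable fun x : Metric.sphere (0 : Ha ⊗[ℂ] Hb) 1 × ℝ =>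
      (U x.2 : (Ha ⊗[ℂ] Hb) →L[ℂ] (Ha ⊗[ℂ] Hb)) x.1 :=
    h1.comp ((measurable_subtype_coe.comp measurable_fst).prodMk measurable_snd)
  simp only [expectationDeviation, inner_heisenberg]
  refine (hC.comp h2).sub ?_
  refine Measurable.tsum fun i => ?_
  exact ((hC.comp (hU (e i))).const_mul (p i : ℂ)).comp measurable_snd

/-- The deviation is a continuous function of finitely many matrix elements, each jointly measurable
in the vector and the time. -/
theorem measurable_reducedDeviation
    (hU : ∀ φ : Ha ⊗[ℂ] Hb, Measurable fun t => (U t : (Ha ⊗[ℂ] Hb) →L[ℂ] (Ha ⊗[ℂ] Hb)) φ)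
    (he : ∀ i, ρ.op (e i) = (p i : ℂ) • e i) (hp : HasSum (fun i => (p i : ℝ)) 1) :
    Measurable fun x : Metric.sphere (0 : Ha ⊗[ℂ] Hb) 1 × ℝ => reducedDeviation ρ U x.1 x.2 := by
  let b := stdOrthonormalBasis ℂ Ha
  let n := Module.finrank ℂ Ha
  let g : (Fin n → Fin n → ℂ) → ℝ := fun m =>
    traceNorm (∑ i, ∑ j, m i j • InnerProductSpace.rankOne ℂ (b i) (b j))
  have hg : Continuous g := continuous_traceNorm.comp (by fun_prop)
  have h : ∀ x : Metric.sphere (0 : Ha ⊗[ℂ] Hb) 1 × ℝ, reducedDeviation ρ U x.1 x.2 =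
      g fun i j => expectationDeviation e p (heisenberg U (rankOneTensor (b i) (b j)) x.2) x.1 := by
    intro x
    simp only [g, ← inner_reducedDifference e ρ U he hp]
    rw [← ContinuousLinearMap.eq_sum_inner_smul_rankOne]
    rfl
  simp only [h]
  refine hg.measurable.comp (measurable_pi_lambda _ fun i => measurable_pi_lambda _ fun j => ?_)
  exact measurable_expectationDeviation_heisenberg e U hU _

end

/-! ### Time averages: Fubini and Markov -/

section

variable {Ha Hb : Type*} [NormedAddCommGroup Ha] [InnerProductSpace ℂ Ha] [FiniteDimensional ℂ Ha]
  [NormedAddCommGroup Hb] [InnerProductSpace ℂ Hb] [CompleteSpace Hb]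
  [TopologicalSpace.SeparableSpace Hb] [MeasurableSpace (Ha ⊗[ℂ] Hb)] [BorelSpace (Ha ⊗[ℂ] Hb)]
  {ι : Type*} (e : HilbertBasis ι ℂ (Ha ⊗[ℂ] Hb)) {p : ι → ℝ≥0}
  (ρ : DensityOperator (Ha ⊗[ℂ] Hb)) (U : ℝ → unitary ((Ha ⊗[ℂ] Hb) →L[ℂ] (Ha ⊗[ℂ] Hb)))

theorem DensityOperator.finrank_left_pos {Ha Hb : Type*} [NormedAddCommGroup Ha]
    [InnerProductSpace ℂ Ha] [FiniteDimensional ℂ Ha] [NormedAddCommGroup Hb]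
    [InnerProductSpace ℂ Hb] (ρ : DensityOperator (Ha ⊗[ℂ] Hb)) : 0 < Module.finrank ℂ Ha := by
  by_contra h
  have h0 : Subsingleton Ha := (Module.finrank_zero_iff (R := ℂ)).1 (by omega)
  have h1 : ∀ x : Ha ⊗[ℂ] Hb, x = 0 := by
    intro x
    induction x with
    | zero => rfl
    | tmul a y => rw [Subsingleton.elim a 0, TensorProduct.zero_tmul]
    | add x y hx hy => rw [hx, hy, add_zero]
  obtain ⟨w, f, hf⟩ := ρ.trace_eq_one
  have h2 : ∀ i, ⟪f i, ρ.op (f i)⟫_ℂ = 0 := fun i => by rw [h1 (f i), inner_zero_left]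
  simp only [h2] at hf
  exact zero_ne_one (hasSum_zero.unique hf)

theorem intervalIntegrable_reducedDeviation {κ : Type*} [Fintype κ] [DecidableEq κ]
    [AddCommGroup κ] (b : OrthonormalBasis κ ℂ Ha)
    (hU : ∀ φ : Ha ⊗[ℂ] Hb, Measurable fun t => (U t : (Ha ⊗[ℂ] Hb) →L[ℂ] (Ha ⊗[ℂ] Hb)) φ)
    (he : ∀ i, ρ.op (e i) = (p i : ℂ) • e i) (hp : HasSum (fun i => (p i : ℝ)) 1)
    (ψ : Metric.sphere (0 : Ha ⊗[ℂ] Hb) 1) (a c : ℝ) :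
    IntervalIntegrable (fun t => reducedDeviation ρ U ψ t) volume a c := by
  have hm : Measurable fun t => reducedDeviation ρ U ψ.1 t := by
    let f : Metric.sphere (0 : Ha ⊗[ℂ] Hb) 1 × ℝ → ℝ := fun x => reducedDeviation ρ U x.1 x.2
    have h1 : Measurable f := measurable_reducedDeviation e ρ U hU he hp
    change Measurable fun t => f (ψ, t)
    exact h1.comp measurable_prodMk_left
  refine (intervalIntegrable_const (c := (2 * Fintype.card κ : ℝ))).mono_fun
    hm.aestronglyMeasurable (Filter.Eventually.of_forall fun t => ?_)
  have h := reducedDeviation_le_two_mul_card e ρ U b he hp (mem_sphere_zero_iff_norm.1 ψ.2) t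
  beta_reduce
  rw [Real.norm_of_nonneg (reducedDeviation_nonneg ρ U _ t), Real.norm_of_nonneg (by positivity)]
  exact h

theorem measurable_intervalIntegral_reducedDeviation
    (hU : ∀ φ : Ha ⊗[ℂ] Hb, Measurable fun t => (U t : (Ha ⊗[ℂ] Hb) →L[ℂ] (Ha ⊗[ℂ] Hb)) φ)
    (he : ∀ i, ρ.op (e i) = (p i : ℂ) • e i) (hp : HasSum (fun i => (p i : ℝ)) 1)
    {T : ℝ} (hT : 0 ≤ T) :
    Measurable fun ψ : Metric.sphere (0 : Ha ⊗[ℂ] Hb) 1 =>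
      ∫ t in (0 : ℝ)..T, reducedDeviation ρ U ψ t := by
  simp only [intervalIntegral.integral_of_le hT]
  exact ((measurable_reducedDeviation e ρ U hU he hp).stronglyMeasurable.integral_prod_right
    (ν := volume.restrict (Set.Ioc 0 T))).measurable

/-- On the event, the time integral of the averaged exponentials g is at least T. Its expectation is
at most T times the moment bound at a fixed time, which is the same for every time and every signed
shift. -/
theorem scroogeMeasure_timeAverage_le {κ : Type*} [Fintype κ] [DecidableEq κ] [AddCommGroup κ]
    (b : OrthonormalBasis κ ℂ Ha)
    (hU : ∀ φ : Ha ⊗[ℂ] Hb, Measurable fun t => (U t : (Ha ⊗[ℂ] Hb) →L[ℂ] (Ha ⊗[ℂ] Hb)) φ)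
    (he : ∀ i, ρ.op (e i) = (p i : ℂ) • e i) (hp1 : ∑' i, (p i : ℝ≥0∞) = 1)
    {r : ℝ} (hr0 : 0 < r) (hr1 : r ≤ 1 / 10) (hr : ∀ i, (p i : ℝ) ≤ r)
    {δ T : ℝ} (hδ0 : 0 < δ) (hδ2 : δ ≤ 2) (hδr : 512 * r ≤ δ ^ 2) (hT : 0 < T) :
    scroogeMeasure e p {ψ : Metric.sphere (0 : Ha ⊗[ℂ] Hb) 1 |
      (1 / T) * (∫ t in (0 : ℝ)..T, reducedDeviation ρ U ψ t) > Fintype.card κ * δ} ≤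
      ENNReal.ofReal (5 * Real.exp (2 * r - δ ^ 2 / (512 * r))) := by
  have hp := hasSum_coe_of_tsum_eq_one hp1
  have := e.countable
  have := isProbabilityMeasure_scroogeMeasure e hp1
  have hn : (0 : ℝ) < Fintype.card κ := by exact_mod_cast Fintype.card_pos
  let K := κ × (κ → ℤˣ)
  have hK : (0 : ℝ) < Fintype.card K := by exact_mod_cast Fintype.card_pos
  -- This s minimises 128rs² − sδ, with minimum −δ²/(512r). The condition s ≤ 1/(64r) amounts to δ ≤
  -- 4.
  set s : ℝ := δ / (256 * r) with hs
  have hs0 : 0 < s := by positivity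
  -- Chosen so that 2τ(x/δ − 1) = sx − sδ. Bernoulli's inequality needs τ ≥ 1, which is 512r ≤ δ².
  set τ : ℝ := s * δ / 2 with hτ
  have hτ1 : 1 ≤ τ := by
    rw [hτ, hs]
    rw [le_div_iff₀ (by norm_num), div_mul_eq_mul_div, le_div_iff₀ (by positivity)]
    nlinarith
  have hs64 : s ≤ 1 / (64 * r) := by
    rw [hs, div_le_div_iff₀ (by positivity) (by positivity)]
    nlinarith
  let x : K → Metric.sphere (0 : Ha ⊗[ℂ] Hb) 1 × ℝ → ℝ := fun k y =>
    ‖expectationDeviation e p (heisenberg U (signedShift b (Equiv.addRight k.1) k.2) y.2) y.1‖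
  have hxm : ∀ k, Measurable (x k) := fun k =>
    (measurable_expectationDeviation_heisenberg e U hU _).norm
  have hx2 : ∀ k y, x k y ≤ 2 := fun k y =>
    norm_expectationDeviation_signedShift_le e U b hp (mem_sphere_zero_iff_norm.1 y.1.2) y.2 _ _
  let g : Metric.sphere (0 : Ha ⊗[ℂ] Hb) 1 × ℝ → ℝ := fun y =>
    (∑ k, Real.exp (2 * τ * (x k y / δ - 1))) / Fintype.card K
  have hgm : Measurable g := by fun_prop
  have hg0 : ∀ y, 0 ≤ g y := fun y => by positivity
  have hgle : ∀ ψ t, 1 + 2 * τ * (reducedDeviation ρ U ψ.1 t / (Fintype.card κ * δ) - 1) ≤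
      g (ψ, t) := by
    intro ψ t
    refine one_add_mul_sub_one_le_average_exp hτ1 hδ0 (fun k => norm_nonneg _) ?_
    have h1 := reducedDeviation_le e ρ U b he hp ψ.1 t
    rw [div_mul_eq_mul_div, mul_div_mul_right _ _ hδ0.ne', div_le_iff₀ hn, mul_comm]
    exact h1
  have hgexp : ∀ y, ENNReal.ofReal (g y) = ENNReal.ofReal (Real.exp (-(s * δ)) / Fintype.card K) *
      ∑ k, ENNReal.ofReal (Real.exp (s * x k y)) := by
    intro y
    rw [← ENNReal.ofReal_sum_of_nonneg fun k _ => (Real.exp_pos _).le,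
      ← ENNReal.ofReal_mul (by positivity)]
    congr 1
    simp only [g]
    rw [div_mul_eq_mul_div, Finset.mul_sum]
    congr 1
    refine Finset.sum_congr rfl fun k _ => ?_
    rw [← Real.exp_add, hτ]
    congr 1
    field_simp
    ring
  have hgexp_m : ∀ k, Measurable fun y => ENNReal.ofReal (Real.exp (s * x k y)) := by
    intro k
    fun_prop
  set μT : Measure ℝ := volume.restrict (Set.Ioc 0 T) with hμT
  have hμTu : μT Set.univ = ENNReal.ofReal T := by simp [hμT]
  set B := ENNReal.ofReal (5 * Real.exp (2 * r - δ ^ 2 / (512 * r))) with hB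
  have hgt : ∀ t, ∫⁻ ψ, ENNReal.ofReal (g (ψ, t)) ∂scroogeMeasure e p ≤ B := by
    intro t
    have h1 : ∀ k : K, ∫⁻ ψ, ENNReal.ofReal (Real.exp (s * x k (ψ, t))) ∂scroogeMeasure e p ≤
        ENNReal.ofReal (5 * Real.exp (2 * r + 128 * r * s ^ 2)) := fun k =>
      lintegral_exp_norm_scroogeMeasure_le e hp1 hr0 hr1 hr
        ((norm_heisenberg U _ t).trans_le (norm_signedShift_le b _ _))
        (hasSum_inner_eigenbasis e hp.summable _) hs0.le hs64
    simp only [hgexp]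
    rw [lintegral_const_mul' _ _ ENNReal.ofReal_ne_top,
      lintegral_finsetSum _ fun k _ =>
        show Measurable fun ψ => ENNReal.ofReal (Real.exp (s * x k (ψ, t))) from
          (hgexp_m k).comp measurable_prodMk_right]
    refine (mul_le_mul_right (Finset.sum_le_card_nsmul _ _ _ fun k _ => h1 k) _).trans_eq ?_
    rw [nsmul_eq_mul, Finset.card_univ, ← ENNReal.ofReal_natCast,
      ← ENNReal.ofReal_mul (by positivity), ← ENNReal.ofReal_mul (by positivity), hB]
    congr 1
    have h2 : Real.exp (2 * r - δ ^ 2 / (512 * r)) =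
        Real.exp (-(s * δ)) * Real.exp (2 * r + 128 * r * s ^ 2) := by
      rw [← Real.exp_add, hs]
      congr 1
      field_simp
      ring
    rw [h2]
    have hK' : (Fintype.card K : ℝ) ≠ 0 := hK.ne'
    field_simp
  let G : Metric.sphere (0 : Ha ⊗[ℂ] Hb) 1 → ℝ≥0∞ := fun ψ => ∫⁻ t, ENNReal.ofReal (g (ψ, t)) ∂μT
  have hGm : Measurable G := hgm.ennreal_ofReal.lintegral_prod_right'
  have hGint : ∫⁻ ψ, G ψ ∂scroogeMeasure e p ≤ ENNReal.ofReal T * B := by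
    simp only [G]
    rw [lintegral_lintegral_swap (f := fun ψ t => ENNReal.ofReal (g (ψ, t)))
      hgm.ennreal_ofReal.aemeasurable]
    refine (lintegral_mono hgt).trans_eq ?_
    rw [lintegral_const, hμTu, mul_comm]
  have hsub : {ψ : Metric.sphere (0 : Ha ⊗[ℂ] Hb) 1 |
      (1 / T) * (∫ t in (0 : ℝ)..T, reducedDeviation ρ U ψ t) > Fintype.card κ * δ} ⊆
      {ψ | ENNReal.ofReal T ≤ G ψ} := by
    intro ψ hψ
    have hψ' : Fintype.card κ * δ * T < ∫ t in (0 : ℝ)..T, reducedDeviation ρ U ψ t := by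
      have : Fintype.card κ * δ < (1 / T) * (∫ t in (0 : ℝ)..T, reducedDeviation ρ U ψ t) := hψ
      rwa [one_div, inv_mul_eq_div, lt_div_iff₀ hT] at this
    have hint := intervalIntegrable_reducedDeviation e ρ U b hU he hp ψ 0 T
    have hgint : Integrable (fun t => g (ψ, t)) μT := by
      refine Integrable.of_bound (C := Real.exp (2 * τ * (2 / δ)))
        (hgm.comp measurable_prodMk_left).aestronglyMeasurable
        (Filter.Eventually.of_forall fun t => ?_)
      rw [Real.norm_of_nonneg (hg0 _)]
      simp only [g]
      rw [div_le_iff₀ hK]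
      refine (Finset.sum_le_card_nsmul _ _ (Real.exp (2 * τ * (2 / δ))) fun k _ => ?_).trans_eq
        (by rw [nsmul_eq_mul, Finset.card_univ, mul_comm])
      have h1 := div_le_div_of_nonneg_right (hx2 k (ψ, t)) hδ0.le
      gcongr
      linarith
    have hYint : Integrable (fun t => reducedDeviation ρ U ψ.1 t) μT :=
      (intervalIntegrable_iff_integrableOn_Ioc_of_le hT.le).1 hint
    have hYint' : Integrable
        (fun t => reducedDeviation ρ U ψ.1 t / (Fintype.card κ * δ) - 1) μT :=
      (hYint.div_const _).sub (integrable_const _)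
    have h1 : T ≤ ∫ t, g (ψ, t) ∂μT := by
      have h2 : ∫ t, (1 + 2 * τ * (reducedDeviation ρ U ψ.1 t / (Fintype.card κ * δ) - 1)) ∂μT =
          T + 2 * τ * ((∫ t in (0 : ℝ)..T, reducedDeviation ρ U ψ t) /
            (Fintype.card κ * δ) - T) := by
        rw [integral_add (integrable_const _) (hYint'.const_mul _), integral_const_mul,
          integral_sub (hYint.div_const _) (integrable_const _), integral_div,
          intervalIntegral.integral_of_le hT.le]
        simp [measureReal_def, hT.le, hμT]
      have h3 : 0 ≤ (∫ t in (0 : ℝ)..T, reducedDeviation ρ U ψ t) / (Fintype.card κ * δ) - T := by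
        rw [sub_nonneg, le_div_iff₀ (by positivity)]
        linarith
      calc T ≤ T + 2 * τ * ((∫ t in (0 : ℝ)..T, reducedDeviation ρ U ψ t) /
            (Fintype.card κ * δ) - T) := by
            have : 0 ≤ 2 * τ := by linarith
            nlinarith
        _ = _ := h2.symm
        _ ≤ _ := integral_mono ((integrable_const _).add (hYint'.const_mul _)) hgint fun t => hgle ψ t
    change ENNReal.ofReal T ≤ ∫⁻ t, ENNReal.ofReal (g (ψ, t)) ∂μT
    rw [← ofReal_integral_eq_lintegral_ofReal hgint (Filter.Eventually.of_forall fun t => hg0 _)]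
    exact ENNReal.ofReal_le_ofReal h1
  refine (measure_mono hsub).trans ?_
  -- Markov's inequality at level T; the factor T then cancels.
  have h1 := (mul_meas_ge_le_lintegral (μ := scroogeMeasure e p) hGm (ENNReal.ofReal T)).trans hGint
  exact (ENNReal.mul_le_mul_iff_right (by simpa using hT) ENNReal.ofReal_ne_top).1 h1

end

/-! ### The theorem: parameter ranges and constants -/

theorem corollary3 {Ha Hb : Type*}
    [NormedAddCommGroup Ha] [InnerProductSpace ℂ Ha] [FiniteDimensional ℂ Ha]
    [NormedAddCommGroup Hb] [InnerProductSpace ℂ Hb] [CompleteSpace Hb]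
    [TopologicalSpace.SeparableSpace Hb]
    [MeasurableSpace (Ha ⊗[ℂ] Hb)] [BorelSpace (Ha ⊗[ℂ] Hb)]
    (ρ : DensityOperator (Ha ⊗[ℂ] Hb))
    (U : ℝ → unitary ((Ha ⊗[ℂ] Hb) →L[ℂ] (Ha ⊗[ℂ] Hb)))
    (hU : ∀ φ : Ha ⊗[ℂ] Hb,
      Measurable fun t => (U t : (Ha ⊗[ℂ] Hb) →L[ℂ] (Ha ⊗[ℂ] Hb)) φ)
    (ε T : ℝ) (hε : 0 < ε) (hT : 0 < T) :
    (∀ ψ : Metric.sphere (0 : Ha ⊗[ℂ] Hb) 1,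
      IntervalIntegrable (fun t => reducedDeviation ρ U ψ t) volume 0 T) ∧
    MeasurableSet {ψ : Metric.sphere (0 : Ha ⊗[ℂ] Hb) 1 |
      (1 / T) * (∫ t in (0 : ℝ)..T, reducedDeviation ρ U ψ t) > ε} ∧
    GAP ρ {ψ : Metric.sphere (0 : Ha ⊗[ℂ] Hb) 1 |
      (1 / T) * (∫ t in (0 : ℝ)..T, reducedDeviation ρ U ψ t) > ε} ≤
      ENNReal.ofReal (9 * (Module.finrank ℂ Ha : ℝ) ^ 2 *
        Real.exp (-((1 / (2304 * Real.pi ^ 2)) * ε ^ 2 /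
          (36 * (Module.finrank ℂ Ha : ℝ) ^ 2 * ‖ρ.op‖)))) := by
  set e := ρ.exists_eigenbasis.choose_spec.choose with he_def
  set p := ρ.exists_eigenbasis.choose_spec.choose_spec.choose with hp_def
  have he : ∀ i, ρ.op (e i) = (p i : ℂ) • e i :=
    ρ.exists_eigenbasis.choose_spec.choose_spec.choose_spec
  have hp1 : ∑' i, (p i : ℝ≥0∞) = 1 := ρ.tsum_eigenvalues e he
  have hp := hasSum_coe_of_tsum_eq_one hp1
  set n := Module.finrank ℂ Ha with hn_def
  have hn : 0 < n := ρ.finrank_left_pos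
  -- Positivity of n makes `Fin n` a cyclic group, as the shifts require.
  have : NeZero n := ⟨hn.ne'⟩
  let b : OrthonormalBasis (Fin n) ℂ Ha := stdOrthonormalBasis ℂ Ha
  have hn1 : (1 : ℝ) ≤ n := by exact_mod_cast hn
  have hint := intervalIntegrable_reducedDeviation e ρ U b hU he hp
  have hr : ∀ i, (p i : ℝ) ≤ ‖ρ.op‖ := ρ.eigenvalue_le_norm e he
  have hr0 : 0 < ‖ρ.op‖ := by
    by_contra h
    have h0 : ∀ i, (p i : ℝ) = 0 := fun i =>
      le_antisymm ((hr i).trans (not_lt.1 h)) (NNReal.coe_nonneg _)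
    simp only [h0] at hp
    exact zero_ne_one (hasSum_zero.unique hp)
  refine ⟨fun ψ => hint ψ 0 T, ?_, ?_⟩
  · exact measurableSet_lt measurable_const
      ((measurable_intervalIntegral_reducedDeviation e ρ U hU he hp hT.le).const_mul _)
  set r := ‖ρ.op‖ with hr_def
  set δ := ε / n with hδ
  have hδ0 : 0 < δ := by positivity
  have hnδ : n * δ = ε := by rw [hδ]; field_simp
  set E := (1 / (2304 * Real.pi ^ 2)) * ε ^ 2 / (36 * (n : ℝ) ^ 2 * r) with hE
  -- Here 82944 = 2304 · 36, and the factor π² ≥ 1 is given away.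
  have hEle : E ≤ δ ^ 2 / (82944 * r) := by
    have h1 : E = δ ^ 2 / (82944 * r) / Real.pi ^ 2 := by
      rw [hE, ← hnδ]
      field_simp
      norm_num
    rw [h1]
    exact div_le_self (by positivity) (by nlinarith [Real.pi_gt_three])
  -- For E ≤ 1 the claimed bound is at least 9/e ≥ 3, so it says nothing about a probability.
  have htriv : E ≤ 1 → GAP ρ {ψ : Metric.sphere (0 : Ha ⊗[ℂ] Hb) 1 |
      (1 / T) * (∫ t in (0 : ℝ)..T, reducedDeviation ρ U ψ t) > ε} ≤
      ENNReal.ofReal (9 * (n : ℝ) ^ 2 * Real.exp (-E)) := by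
    intro hE1
    refine prob_le_one.trans ?_
    rw [ENNReal.one_le_ofReal]
    have h1 : Real.exp (-1) ≤ Real.exp (-E) := Real.exp_le_exp.2 (by linarith)
    have h2 : 1 / 3 ≤ Real.exp (-1) := by
      rw [Real.exp_neg, ← one_div]
      gcongr
      exact Real.exp_one_lt_three.le
    nlinarith
  -- For δ > 2 the event is empty, since the deviation never exceeds 2n. For δ ≤ 2, either r > 1/10
  -- or δ² < 512r forces E ≤ 1.
  rcases lt_or_ge 2 δ with hδ2 | hδ2
  · have hempty : {ψ : Metric.sphere (0 : Ha ⊗[ℂ] Hb) 1 |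
        (1 / T) * (∫ t in (0 : ℝ)..T, reducedDeviation ρ U ψ t) > ε} = ∅ := by
      rw [Set.eq_empty_iff_forall_notMem]
      intro ψ hψ
      have h1 : ∫ t in (0 : ℝ)..T, reducedDeviation ρ U ψ t ≤ ∫ t in (0 : ℝ)..T, (2 * n : ℝ) := by
        refine intervalIntegral.integral_mono_on hT.le (hint ψ 0 T) intervalIntegrable_const
          fun t _ => ?_
        simpa using reducedDeviation_le_two_mul_card e ρ U b he hp (mem_sphere_zero_iff_norm.1 ψ.2) t
      rw [intervalIntegral.integral_const, sub_zero, smul_eq_mul] at h1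
      have h2 : ε < (1 / T) * (∫ t in (0 : ℝ)..T, reducedDeviation ρ U ψ t) := hψ
      rw [one_div, inv_mul_eq_div, lt_div_iff₀ hT] at h2
      nlinarith [mul_pos (zero_lt_one.trans_le hn1) hT]
    rw [hempty, measure_empty]
    exact zero_le
  rcases lt_or_ge (1 / 10) r with hr1 | hr1
  · refine htriv (hEle.trans ?_)
    rw [div_le_one (by positivity)]
    nlinarith
  rcases lt_or_ge (δ ^ 2) (512 * r) with hδr | hδr
  · refine htriv (hEle.trans ?_)
    rw [div_le_one (by positivity)]
    linarith
  have hmain := scroogeMeasure_timeAverage_le e ρ U b hU he hp1 hr0 hr1 hr hδ0 hδ2 hδr hT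
  rw [Fintype.card_fin, hnδ] at hmain
  refine hmain.trans (ENNReal.ofReal_le_ofReal ?_)
  -- Since 2r ≤ 1/5, the prefactor is at most 5 · exp(1/5) ≤ 25/4 ≤ 9; the factor n² ≥ 1 is not
  -- needed.
  have h1 : E ≤ δ ^ 2 / (512 * r) := hEle.trans (by gcongr; norm_num)
  have h2 : Real.exp (1 / 5) ≤ 5 / 4 := by
    have h3 := Real.add_one_le_exp (-(1 / 5) : ℝ)
    rw [Real.exp_neg] at h3
    rw [← inv_inv (Real.exp (1 / 5))]
    exact inv_le_of_inv_le₀ (by norm_num) (by norm_num at h3 ⊢; exact h3)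
  have h4 : Real.exp (2 * r - δ ^ 2 / (512 * r)) ≤ 5 / 4 * Real.exp (-E) := by
    calc Real.exp (2 * r - δ ^ 2 / (512 * r)) ≤ Real.exp (1 / 5 + -E) := by gcongr; linarith
      _ ≤ _ := by rw [Real.exp_add]; gcongr
  have h5 : Real.exp (-E) ≤ (n : ℝ) ^ 2 * Real.exp (-E) :=
    le_mul_of_one_le_left (Real.exp_pos _).le (one_le_pow₀ hn1)
  have h6 := Real.exp_pos (-E)
  linarith
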